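/- For $n,k\in\mathbb{N}$, nonzero vectors $v_1,\dots,v_k\in\mathbb{R}^n$ and reals $\mu_1,\dots,\mu_k$, the $k$ hyperplanes $\{x\in\mathbb{R}^n:\langle v_i,x\rangle=\mu_i\}$ form an essential cover of the $n$-cube $\{0,1\}^n$ if (E1) for every $x\in\{0,1\}^n$ there is $i$ with $\langle v_i,x\rangle=\mu_i$; (E2) for every coordinate $j\in\{1,\dots,n\}$ there is $i$ with $v_{ij}\neq 0$; and (E3) for every $i$ there is $x\in\{0,1\}^n$ such that $\langle v_i,x\rangle=\mu_i$ and $\langle v_j,x\rangle\neq\mu_j$ for all $j\neq i$. Theorem. An essential cover of the $n$-cube has $\Omega\left(\frac{n^{5/9}}{(\log n)^{4/9}}\right)$ hyperplanes; that is, there is an absolute constant $c>0$ such that, for every $n\ge 2$, every essential cover of the $n$-cube by $k$ hyperplanes satisfies $$k\ \ge\ c\,\frac{n^{5/9}}{(\log n)^{4/9}},$$ where $\log$ is the natural logarithm. -/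

import Mathlib

/-- The vertex set `{0,1}^n` of the `n`-cube, as a subset of `ℝ^n`. -/
def cubeVertices (n : ℕ) : Set (Fin n → ℝ) :=
  {x | ∀ j, x j = 0 ∨ x j = 1}

/-- The hyperplane `{x ∈ ℝ^n : ⟨v, x⟩ = m}` (a hyperplane when `v ≠ 0`). -/
def hyperplane {n : ℕ} (v : Fin n → ℝ) (m : ℝ) : Set (Fin n → ℝ) :=
  {x | v ⬝ᵥ x = m}

/-- The `k` hyperplanes with equations `⟨v i, x⟩ = m i` form an essential cover of the
`n`-cube `{0,1}^n`. -/
structure IsEssentialCover {n k : ℕ} (v : Fin k → Fin n → ℝ) (m : Fin k → ℝ) : Prop where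
  /-- Each equation defines a hyperplane. -/
  ne_zero : ∀ i, v i ≠ 0
  /-- Every vertex of the cube is covered. -/
  covers : ∀ x ∈ cubeVertices n, ∃ i, x ∈ hyperplane (v i) (m i)
  /-- Every variable appears in at least one equation. -/
  all_vars : ∀ j, ∃ i, v i j ≠ 0
  /-- No hyperplane is redundant: each covers a vertex that no other one covers. -/
  minimal : ∀ i, ∃ x ∈ cubeVertices n, x ∈ hyperplane (v i) (m i) ∧
    ∀ j, j ≠ i → x ∉ hyperplane (v j) (m j)

/-! View the normals as the rows of a $k\times n$ matrix and suppose $n^5\gg k^9(\log 2k)^4$. A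
polynomial argument gives each row at most $2k$ nonzero entries
(`IsEssentialCover.card_support_le`). Double counting and an extremal choice then give a nonempty
set $S$ of columns, each with $O(k^2/n)$ nonzero entries, such that any set $E$ of rows meeting $S$
touches at least $\Lambda|E|$ columns of $S$, where $\Lambda=n/4k$. Take a vertex private to a row
meeting $S$ and change only its coordinates in $S$: rows not meeting $S$ are still missed, so an
uncovered vertex arises once all rows meeting $S$ are avoided (`exists_subset_sum_ne`).

To avoid them, remove greedily a set $K$ of columns until no remaining column is heavy
(`exists_saturated_list`). A uniform choice on $K$ treats two kinds of rows. Rows that lost mass on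
many scales are, with high probability, so far from their target that no completion reaches it. Rows
supported inside $K$ are fewer than $\sqrt\Lambda/2$ by expansion, and each is hit with probability
at most $1/\sqrt\Lambda$ by Littlewood–Offord. The other rows are avoided on $S\setminus K$: Bang's
lemma gives a point of the solid cube far from all their hyperplanes, and rounding keeps it off
them.

The exponents come from $|K|\lesssim k^3(\log 2k)^2/n$, which must be below a constant times
$\Lambda^{3/2}$. -/

open Finset

/-! ### Sparsity of essential hyperplanes by multilinear polynomials -/

/-- Reindexing pairs `(S, j)` with `j ∈ S ⊆ X` by `(S \ {j}, j)`. -/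
theorem sum_powerset_sum_erase {α : Type*} [DecidableEq α] (X : Finset α)
    (F : α → Finset α → ℝ) :
    ∑ S ∈ X.powerset, ∑ j ∈ S, F j (S.erase j) = ∑ T ∈ X.powerset, ∑ j ∈ X \ T, F j T := by
  rw [Finset.sum_sigma', Finset.sum_sigma']
  refine Finset.sum_nbij' (fun p => ⟨p.1.erase p.2, p.2⟩) (fun p => ⟨insert p.2 p.1, p.2⟩)
    ?_ ?_ ?_ ?_ ?_
  · rintro ⟨S, j⟩ h
    simp only [mem_sigma, mem_powerset, mem_sdiff] at h ⊢
    exact ⟨(erase_subset _ _).trans h.1, h.1 h.2, by simp⟩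
  · rintro ⟨S, j⟩ h
    simp only [mem_sigma, mem_powerset, mem_sdiff] at h ⊢
    exact ⟨insert_subset h.2.1 h.1, by simp⟩
  · rintro ⟨S, j⟩ h
    simp only [mem_sigma, mem_powerset] at h
    simp [insert_erase h.2]
  · rintro ⟨S, j⟩ h
    simp only [mem_sigma, mem_powerset, mem_sdiff] at h
    simp [erase_insert h.2.2]
  · rintro ⟨S, j⟩ h
    rfl

/-- Injectivity of the inclusion map from `e`-subsets to `(e+1)`-subsets below the middle. -/
theorem eq_zero_of_sum_erase_eq_zero {α : Type*} [Fintype α] [DecidableEq α] {e : ℕ}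
    (g : Finset α → ℝ) (hg : ∀ S : Finset α, #S = e + 1 → ∑ j ∈ S, g (S.erase j) = 0)
    (hN : 2 * e < Fintype.card α) {T : Finset α} (hT : #T = e) : g T = 0 := by
  -- Group the $e$-sets by their intersection with $T$. Summing the hypothesis over the $(e+1)$-sets
  -- that meet $T$ in $i$ points gives $(N-2e+i)a_i+(e-i+1)a_{i-1}=0$. As $N>2e$, all $a_i$ vanish,
  -- and $a_e=g(T)$.
  set a : ℕ → ℝ := fun i => ∑ U : Finset α, if #U = e ∧ #(U ∩ T) = i then g U else 0 with ha
  have key : ∀ i, ∑ U : Finset α, ∑ j ∈ univ \ U,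
      (if #U = e ∧ #(insert j U ∩ T) = i then g U else 0) = 0 := by
    intro i
    have h := sum_powerset_sum_erase (univ : Finset α)
      (fun j U => if #U = e ∧ #(insert j U ∩ T) = i then g U else 0)
    rw [powerset_univ] at h
    rw [← h]
    refine Finset.sum_eq_zero fun S _ => ?_
    by_cases hS : #S = e + 1 ∧ #(S ∩ T) = i
    · rw [← hg S hS.1]
      refine Finset.sum_congr rfl fun j hj => ?_
      rw [if_pos]
      rw [insert_erase hj, card_erase_of_mem hj]
      exact ⟨by omega, hS.2⟩
    · refine Finset.sum_eq_zero fun j hj => ?_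
      rw [if_neg]
      rw [insert_erase hj, card_erase_of_mem hj]
      have : 0 < #S := card_pos.mpr ⟨j, hj⟩
      rintro ⟨h1, h2⟩
      exact hS ⟨by omega, h2⟩
  have inner : ∀ (i : ℕ) (U : Finset α), ∑ j ∈ univ \ U,
      (if #U = e ∧ #(insert j U ∩ T) = i then g U else 0) =
      ((Fintype.card α : ℝ) - 2 * e + i) * (if #U = e ∧ #(U ∩ T) = i then g U else 0)
      + ((e : ℝ) - i + 1) * (if #U = e ∧ #(U ∩ T) + 1 = i then g U else 0) := by
    intro i U
    by_cases hU : #U = e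
    swap
    · simp [hU]
    simp only [hU, true_and]
    have hsplit : (univ \ U : Finset α) = (univ \ (U ∪ T)) ∪ (T \ U) := by
      ext j; simp only [mem_sdiff, mem_univ, mem_union, true_and]; tauto
    have hdisj : Disjoint (univ \ (U ∪ T) : Finset α) (T \ U) := by
      rw [Finset.disjoint_left]; intro j; simp only [mem_sdiff, mem_univ, mem_union]; tauto
    rw [hsplit, Finset.sum_union hdisj]
    have h1 : ∑ j ∈ univ \ (U ∪ T), (if #(insert j U ∩ T) = i then g U else 0)
        = ((#(univ \ (U ∪ T)) : ℕ) : ℝ) * (if #(U ∩ T) = i then g U else 0) := by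
      rw [← nsmul_eq_mul, ← Finset.sum_const]
      refine Finset.sum_congr rfl fun j hj => ?_
      simp only [mem_sdiff, mem_univ, mem_union, true_and, not_or] at hj
      rw [insert_inter_of_notMem hj.2]
    have h2 : ∑ j ∈ T \ U, (if #(insert j U ∩ T) = i then g U else 0)
        = ((#(T \ U) : ℕ) : ℝ) * (if #(U ∩ T) + 1 = i then g U else 0) := by
      rw [← nsmul_eq_mul, ← Finset.sum_const]
      refine Finset.sum_congr rfl fun j hj => ?_
      simp only [mem_sdiff] at hj
      rw [insert_inter_of_mem hj.1, card_insert_of_notMem (by simp [hj.2])]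
    rw [h1, h2]
    have c1 : #(univ \ (U ∪ T)) + #(U ∪ T) = Fintype.card α := by
      rw [card_sdiff_add_card_eq_card (subset_univ _), card_univ]
    have c2 := card_union_add_card_inter U T
    have c3 : #(T \ U) + #(U ∩ T) = #T := by
      rw [inter_comm]; exact card_sdiff_add_card_inter T U
    congr 1
    · split_ifs with h
      · congr 1
        have : (#(univ \ (U ∪ T)) : ℝ) + #(U ∪ T) = Fintype.card α := by exact_mod_cast c1
        have h3 : (#(U ∪ T) : ℝ) + i = e + e := by
          rw [← h]; rw [hU, hT] at c2; exact_mod_cast c2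
        linarith
      · simp
    · split_ifs with h
      · congr 1
        have h3 : (#(T \ U) : ℝ) + #(U ∩ T) = e := by rw [hT] at c3; exact_mod_cast c3
        have h4 : (#(U ∩ T) : ℝ) + 1 = i := by exact_mod_cast h
        linarith
      · simp
  have rec_a : ∀ i, ((Fintype.card α : ℝ) - 2 * e + i) * a i + ((e : ℝ) - i + 1) *
      (∑ U : Finset α, if #U = e ∧ #(U ∩ T) + 1 = i then g U else 0) = 0 := by
    intro i
    refine Eq.trans ?_ (key i)
    rw [ha, Finset.mul_sum, Finset.mul_sum, ← Finset.sum_add_distrib]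
    exact Finset.sum_congr rfl fun U _ => (inner i U).symm
  have hN' : (2 * e : ℝ) < Fintype.card α := by exact_mod_cast hN
  have hzero : ∀ i, a i = 0 := by
    intro i
    induction i with
    | zero =>
      have h := rec_a 0
      simp only [Nat.add_eq_zero_iff, one_ne_zero, and_false, if_false, Finset.sum_const_zero,
        mul_zero, add_zero, Nat.cast_zero] at h
      exact (mul_eq_zero.mp h).resolve_left (by linarith)
    | succ i ih =>
      have h := rec_a (i + 1)
      simp only [Nat.add_right_cancel_iff] at h
      rw [show (∑ U : Finset α, if #U = e ∧ #(U ∩ T) = i then g U else 0) = a i from rfl, ih,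
        mul_zero, add_zero] at h
      refine (mul_eq_zero.mp h).resolve_left ?_
      have : (0 : ℝ) ≤ ((i + 1 : ℕ) : ℝ) := Nat.cast_nonneg _
      linarith
  have hlast := hzero e
  rw [ha] at hlast
  simp only at hlast
  rw [Finset.sum_eq_single T] at hlast
  · simpa [hT] using hlast
  · intro U _ hne
    rw [if_neg]
    rintro ⟨h1, h2⟩
    apply hne
    have h3 : U ∩ T = U := eq_of_subset_of_card_le inter_subset_left (by omega)
    have h4 : U ∩ T = T := eq_of_subset_of_card_le inter_subset_right (by omega)
    rw [← h3, h4]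
  · simp

theorem eq_zero_of_sum_powerset_eq_zero {α : Type*} [DecidableEq α] (c : Finset α → ℝ)
    (h : ∀ X : Finset α, ∑ T ∈ X.powerset, c T = 0) (X : Finset α) : c X = 0 := by
  induction X using Finset.strongInduction with
  | H X ih =>
    have h1 := h X
    rwa [← Finset.sum_subset (singleton_subset_iff.mpr (mem_powerset_self X)),
      Finset.sum_singleton] at h1
    intro T hT hne
    rw [mem_powerset] at hT
    rw [mem_singleton] at hne
    exact ih T (hT.ssubset_of_ne hne)

/-- Multilinear coefficients of the product of an affine form with a multilinear polynomial. -/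
theorem sum_powerset_mul_affine {α : Type*} [DecidableEq α] (v : α → ℝ) (m : ℝ)
    (c : Finset α → ℝ) (X : Finset α) :
    ∑ S ∈ X.powerset, ((∑ j ∈ S, v j - m) * c S + ∑ j ∈ S, v j * c (S.erase j))
      = (∑ j ∈ X, v j - m) * ∑ T ∈ X.powerset, c T := by
  rw [Finset.sum_add_distrib, sum_powerset_sum_erase X (fun j U => v j * c U),
    ← Finset.sum_add_distrib, Finset.mul_sum]
  refine Finset.sum_congr rfl fun T hT => ?_
  rw [mem_powerset] at hT
  rw [← Finset.sum_mul, ← Finset.sum_sdiff hT]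
  ring

/-- On the cube $x_j^2=x_j$, so products reduce to multilinear form, and each affine factor raises
the degree by at most one. -/
theorem exists_coeff_prod_affine {α ι : Type*} [DecidableEq α] [DecidableEq ι]
    (v : ι → α → ℝ) (m : ι → ℝ) (I : Finset ι) :
    ∃ c : Finset α → ℝ, (∀ S : Finset α, #I < #S → c S = 0) ∧
      ∀ X : Finset α, ∑ T ∈ X.powerset, c T = ∏ i ∈ I, (∑ j ∈ X, v i j - m i) := by
  induction I using Finset.induction_on with
  | empty =>
    refine ⟨fun S => if S = ∅ then 1 else 0, ?_, ?_⟩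
    · intro S hS
      refine if_neg ?_
      rintro rfl
      simp at hS
    · intro X
      simp
  | insert i I hi ih =>
    obtain ⟨c, hc, hX⟩ := ih
    refine ⟨fun S => (∑ j ∈ S, v i j - m i) * c S + ∑ j ∈ S, v i j * c (S.erase j), ?_, ?_⟩
    · intro S hS
      rw [card_insert_of_notMem hi] at hS
      simp only
      rw [hc S (by omega), mul_zero, zero_add]
      refine Finset.sum_eq_zero fun j hj => ?_
      rw [hc _ (by rw [card_erase_of_mem hj]; omega), mul_zero]
    · intro X
      rw [sum_powerset_mul_affine, hX, Finset.prod_insert hi]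

/-- If a product of affine forms is not identically zero on a cube and vanishes off a hyperplane
whose normal has no zero coordinate, then the dimension is at most twice the number of forms. -/
theorem card_le_of_prod_affine_mul_eq_zero {α ι : Type*} [Fintype α] [DecidableEq α]
    [DecidableEq ι] (v : ι → α → ℝ) (m : ι → ℝ) (I : Finset ι) (w : α → ℝ) (μ : ℝ)
    (hw : ∀ j, w j ≠ 0) (X₀ : Finset α) (h₀ : ∏ i ∈ I, (∑ j ∈ X₀, v i j - m i) ≠ 0)
    (h : ∀ X : Finset α, (∑ j ∈ X, w j - μ) * ∏ i ∈ I, (∑ j ∈ X, v i j - m i) = 0) :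
    Fintype.card α ≤ 2 * #I := by
  obtain ⟨c, hc, hX⟩ := exists_coeff_prod_affine v m I
  have hmul : ∀ S : Finset α, (∑ j ∈ S, w j - μ) * c S + ∑ j ∈ S, w j * c (S.erase j) = 0 := by
    refine eq_zero_of_sum_powerset_eq_zero _ fun X => ?_
    rw [sum_powerset_mul_affine, hX, h]
  have hex : ∃ T, c T ≠ 0 := by
    by_contra! hall
    apply h₀
    rw [← hX]
    exact Finset.sum_eq_zero fun T _ => hall T
  -- For $T$ of top degree, the coefficients one degree higher in the vanishing product give
  -- $\sum_{j\in S}w_jc(S\setminus j)=0$. Rescaling $c$ by $\prod w_j^{-1}$ removes the weights, and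
  -- injectivity below the middle layer applies.
  obtain ⟨T, hT, hmax⟩ := Finset.exists_max_image (univ.filter fun T => c T ≠ 0) card
    (by obtain ⟨T, hT⟩ := hex; exact ⟨T, by simpa using hT⟩)
  rw [mem_filter] at hT
  have hTI : #T ≤ #I := by
    by_contra! hlt
    exact hT.2 (hc T hlt)
  by_contra! hcard
  have := eq_zero_of_sum_erase_eq_zero (e := #T) (fun U => c U * ∏ j ∈ U, (w j)⁻¹) ?_
    (by omega) (T := T) rfl
  · rcases mul_eq_zero.mp this with h1 | h1
    · exact hT.2 h1
    · rw [Finset.prod_eq_zero_iff] at h1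
      obtain ⟨j, _, hj⟩ := h1
      exact inv_ne_zero (hw j) hj
  · intro S hS
    have hcS : c S = 0 := by
      by_contra hne
      have := hmax S (by simpa using hne)
      omega
    have h1 := hmul S
    rw [hcS, mul_zero, zero_add] at h1
    have h2 : ∑ j ∈ S, c (S.erase j) * ∏ i ∈ S.erase j, (w i)⁻¹
        = (∏ i ∈ S, (w i)⁻¹) * ∑ j ∈ S, w j * c (S.erase j) := by
      rw [Finset.mul_sum]
      refine Finset.sum_congr rfl fun j hj => ?_
      rw [← Finset.mul_prod_erase S _ hj]
      have := hw j
      field_simp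
    rw [h2, h1, mul_zero]

/-- Every hyperplane of an essential cover has at most `2k` nonzero coefficients. -/
theorem IsEssentialCover.card_support_le {n k : ℕ} {v : Fin k → Fin n → ℝ} {m : Fin k → ℝ}
    (h : IsEssentialCover v m) (i : Fin k) : #{j | v i j ≠ 0} ≤ 2 * k := by
  classical
  obtain ⟨x, hx, hxi, hxj⟩ := h.minimal i
  -- Free the coordinates in the support of row $i$ and freeze the others at the private vertex $x$.
  -- The product of the other forms is nonzero at $x$, and by covering it vanishes off hyperplane
  -- $i$.
  let A := {j : Fin n // v i j ≠ 0}
  let y : Finset A → Fin n → ℝ := fun X j =>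
    if hj : v i j ≠ 0 then (if (⟨j, hj⟩ : A) ∈ X then 1 else 0) else x j
  have hy : ∀ X, y X ∈ cubeVertices n := by
    intro X j
    by_cases hj : v i j ≠ 0
    · by_cases hX : (⟨j, hj⟩ : A) ∈ X
      · right; simp only [y, dif_pos hj, if_pos hX]
      · left; simp only [y, dif_pos hj, if_neg hX]
    · simp only [y, dif_neg hj]; exact hx j
  have hdot : ∀ (q : Fin k) X, v q ⬝ᵥ y X
      = ∑ j ∈ X, v q j.1 + ∑ j with ¬ (v i j ≠ 0), v q j * x j := by
    intro q X
    rw [dotProduct, ← Finset.sum_filter_add_sum_filter_not univ (fun j => v i j ≠ 0)]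
    congr 1
    · rw [← Finset.sum_subtype_eq_sum_filter, Finset.subtype_univ]
      rw [← Finset.sum_subset (subset_univ X)]
      · refine Finset.sum_congr rfl fun j hj => ?_
        simp only [y, dif_pos j.2, Subtype.coe_eta, if_pos hj, mul_one]
      · intro j _ hj
        simp only [y, dif_pos j.2, Subtype.coe_eta, if_neg hj, mul_zero]
    · refine Finset.sum_congr rfl fun j hj => ?_
      simp only [y, dif_neg (mem_filter.mp hj).2]
  have hcard := card_le_of_prod_affine_mul_eq_zero (α := A) (fun q j => v q j.1)
    (fun q => m q - ∑ j with ¬ (v i j ≠ 0), v q j * x j) (univ.erase i) (fun j => v i j.1)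
    (m i - ∑ j with ¬ (v i j ≠ 0), v i j * x j) (fun j => j.2)
    (univ.filter fun j => x j.1 = 1) ?_ ?_
  · rw [Fintype.card_subtype, card_erase_of_mem (mem_univ i), card_univ, Fintype.card_fin] at hcard
    omega
  · have hyx : y (univ.filter fun j => x j.1 = 1) = x := by
      funext j
      by_cases hj : v i j ≠ 0
      · simp only [y, dif_pos hj, mem_filter, mem_univ, true_and]
        rcases hx j with h0 | h1
        · rw [if_neg (by rw [h0]; exact zero_ne_one), h0]
        · rw [if_pos h1, h1]
      · simp only [y, dif_neg hj]
    rw [Finset.prod_ne_zero_iff]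
    intro q hq
    have h1 := hdot q (univ.filter fun j => x j.1 = 1)
    rw [hyx] at h1
    have h2 : v q ⬝ᵥ x ≠ m q := hxj q (ne_of_mem_erase hq)
    intro h3
    apply h2
    rw [h1]
    linarith
  · intro X
    obtain ⟨q, hq⟩ := h.covers (y X) (hy X)
    have hq' : v q ⬝ᵥ y X = m q := hq
    rw [hdot] at hq'
    by_cases hqi : q = i
    · subst hqi
      rw [mul_eq_zero]; left; linarith
    · rw [mul_eq_zero]; right
      refine Finset.prod_eq_zero (mem_erase.mpr ⟨hqi, mem_univ q⟩) ?_
      linarith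

/-! ### Littlewood–Offord bound -/

theorem sq_choose_half_mul_le (s : ℕ) : (s.choose (s / 2)) ^ 2 * s ≤ 4 ^ s := by
  -- The factor $2t+1$ rather than $2t$ lets the induction close, through $(2t+1)(2t+3)\le
  -- 4(t+1)^2$.
  have hc : ∀ t : ℕ, t.centralBinom ^ 2 * (2 * t + 1) ≤ 16 ^ t := by
    intro t
    induction t with
    | zero => simp
    | succ t ih =>
      have h := Nat.succ_mul_centralBinom_succ t
      have h2 : (t + 1) ^ 2 * ((t + 1).centralBinom ^ 2 * (2 * (t + 1) + 1))
          ≤ (t + 1) ^ 2 * 16 ^ (t + 1) := by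
        calc (t + 1) ^ 2 * ((t + 1).centralBinom ^ 2 * (2 * (t + 1) + 1))
            = ((t + 1) * (t + 1).centralBinom) ^ 2 * (2 * (t + 1) + 1) := by ring
          _ = (t.centralBinom ^ 2 * (2 * t + 1)) * (4 * (2 * t + 1) * (2 * t + 3)) := by
              rw [h]; ring
          _ ≤ 16 ^ t * ((t + 1) ^ 2 * 16) := by
              refine Nat.mul_le_mul ih ?_
              nlinarith
          _ = (t + 1) ^ 2 * 16 ^ (t + 1) := by ring
      exact Nat.le_of_mul_le_mul_left h2 (by positivity)
  rcases Nat.even_or_odd' s with ⟨t, rfl | rfl⟩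
  · rw [Nat.mul_div_cancel_left _ (by norm_num), ← Nat.centralBinom_eq_two_mul_choose, pow_mul]
    refine le_trans ?_ (hc t)
    gcongr
    omega
  · have h1 : (2 * t + 1) / 2 = t := by omega
    have h2 : 2 * (2 * t + 1).choose t = (t + 1).centralBinom := by
      rw [Nat.centralBinom_eq_two_mul_choose, show 2 * (t + 1) = (2 * t + 1) + 1 by ring,
        Nat.choose_succ_succ' (2 * t + 1) t, two_mul, Nat.choose_symm_half]
    have h3 := hc (t + 1)
    rw [← h2] at h3
    rw [h1]
    have h4 : (16 : ℕ) ^ (t + 1) = 4 * 4 ^ (2 * t + 1) := by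
      rw [pow_succ 4 (2 * t), pow_mul]; ring
    rw [h4] at h3
    have : (2 * t + 1).choose t ^ 2 * (2 * t + 1) ≤ (2 * t + 1).choose t ^ 2 * (2 * (t + 1) + 1) :=
      Nat.mul_le_mul_left _ (by omega)
    nlinarith

/-- The Littlewood–Offord bound of Erdős. -/
theorem card_filter_sum_eq_le {α : Type*} [Fintype α] [DecidableEq α] (v : α → ℝ)
    (hv : ∀ j, v j ≠ 0) (μ : ℝ) :
    #{X : Finset α | ∑ j ∈ X, v j = μ} ≤ (Fintype.card α).choose (Fintype.card α / 2) := by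
  -- Symmetric difference with the negative coordinates replaces $v$ by $|v|$ and shifts the target.
  -- Equal sums of positive weights form an antichain, so Sperner applies.
  set N : Finset α := univ.filter fun j => v j < 0 with hN
  have habs : ∀ X : Finset α, ∑ j ∈ symmDiff X N, |v j| = ∑ j ∈ X, v j + ∑ j ∈ N, |v j| := by
    intro X
    have e1 : symmDiff X N = (X \ N) ∪ (N \ X) := rfl
    rw [e1, Finset.sum_union (disjoint_sdiff_sdiff),
      ← Finset.sum_inter_add_sum_sdiff X N v,
      ← Finset.sum_inter_add_sum_sdiff N X (fun j => |v j|)]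
    have h1 : ∑ j ∈ X \ N, |v j| = ∑ j ∈ X \ N, v j := by
      refine Finset.sum_congr rfl fun j hj => abs_of_nonneg ?_
      simp only [hN, mem_sdiff, mem_filter, mem_univ, true_and, not_lt] at hj
      exact hj.2
    have h2 : ∑ j ∈ N ∩ X, |v j| = - ∑ j ∈ X ∩ N, v j := by
      rw [inter_comm, ← Finset.sum_neg_distrib]
      refine Finset.sum_congr rfl fun j hj => abs_of_neg ?_
      simp only [hN, mem_inter, mem_filter, mem_univ, true_and] at hj
      exact hj.2
    rw [h1, h2]; ring
  set F : Finset (Finset α) := univ.filter fun X => ∑ j ∈ X, v j = μ with hF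
  have hinj : Function.Injective fun X : Finset α => symmDiff X N := symmDiff_left_injective N
  rw [← card_image_of_injective F hinj]
  apply IsAntichain.sperner
  intro A hA B hB hne hle
  simp only [hF, coe_image, Set.mem_image, mem_coe, mem_filter, mem_univ, true_and] at hA hB
  obtain ⟨X, hX, rfl⟩ := hA
  obtain ⟨Y, hY, rfl⟩ := hB
  have hss : symmDiff X N ⊂ symmDiff Y N := ssubset_of_subset_of_ne hle hne
  obtain ⟨j, hjY, hjX⟩ := exists_of_ssubset hss
  have hlt : ∑ j ∈ symmDiff X N, |v j| < ∑ j ∈ symmDiff Y N, |v j| :=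
    Finset.sum_lt_sum_of_subset hss.1 hjY hjX (abs_pos.mpr (hv j)) fun _ _ _ => abs_nonneg _
  rw [habs, habs, hX, hY] at hlt
  exact lt_irrefl _ hlt

/-- Independence in counting form: an event depending only on the coordinates in $A$ has the same
density over $K$ as over $A$. -/
theorem card_powerset_filter_inter {α : Type*} [DecidableEq α] {A K : Finset α} (hAK : A ⊆ K)
    (p : Finset α → Prop) [DecidablePred p] :
    #(K.powerset.filter fun X => p (X ∩ A)) = 2 ^ #(K \ A) * #(A.powerset.filter p) := by
  rw [← card_powerset, ← card_product]
  refine Finset.card_nbij' (fun X => (X \ A, X ∩ A)) (fun q => q.1 ∪ q.2) ?_ ?_ ?_ ?_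
  · intro X hX
    simp only [coe_filter, mem_powerset, Set.mem_ofPred_eq] at hX
    simp only [coe_product, Set.mem_prod, mem_coe, mem_powerset, mem_filter]
    exact ⟨sdiff_subset_sdiff hX.1 le_rfl, inter_subset_right, hX.2⟩
  · rintro ⟨Y, Z⟩ hq
    simp only [coe_product, Set.mem_prod, mem_coe, mem_powerset, mem_filter] at hq
    simp only [coe_filter, mem_powerset, Set.mem_ofPred_eq]
    have e : (Y ∪ Z) ∩ A = Z := by
      ext j
      have h1 := @hq.1 j
      have h2 := @hq.2.1 j
      simp only [mem_sdiff, mem_inter, mem_union] at *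
      tauto
    rw [e]
    exact ⟨union_subset (hq.1.trans sdiff_subset) (hq.2.1.trans hAK), hq.2.2⟩
  · intro X _
    exact sdiff_union_inter X A
  · rintro ⟨Y, Z⟩ hq
    simp only [coe_product, Set.mem_prod, mem_coe, mem_powerset, mem_filter] at hq
    ext j
    · have h1 := @hq.1 j
      have h2 := @hq.2.1 j
      simp only [mem_sdiff, mem_union] at *
      tauto
    · have h1 := @hq.1 j
      have h2 := @hq.2.1 j
      simp only [mem_sdiff, mem_inter, mem_union] at *
      tauto

theorem card_powerset_filter_sum_eq_le {α : Type*} [DecidableEq α] {A : Finset α}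
    (v : α → ℝ) (hv : ∀ j ∈ A, v j ≠ 0) (μ : ℝ) :
    (#(A.powerset.filter fun X => ∑ j ∈ X, v j = μ) : ℝ) * √(#A : ℝ) ≤ 2 ^ #A := by
  have h1 : #(A.powerset.filter fun X => ∑ j ∈ X, v j = μ)
      ≤ #{X : Finset A | ∑ j ∈ X, v j = μ} := by
    refine Finset.card_le_card_of_injOn (fun X => X.subtype (· ∈ A)) ?_ ?_
    · intro X hX
      simp only [coe_filter, mem_powerset, Set.mem_ofPred_eq] at hX
      simp only [coe_filter, mem_univ, true_and, Set.mem_ofPred_eq]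
      rw [Finset.sum_subtype_of_mem (fun j => v j) hX.1]
      exact hX.2
    · intro X hX Y hY hXY
      simp only [coe_filter, mem_powerset, Set.mem_ofPred_eq] at hX hY
      rw [← Finset.subtype_map_of_mem hX.1, ← Finset.subtype_map_of_mem hY.1]
      simp only at hXY
      rw [hXY]
  have h2 := h1.trans (card_filter_sum_eq_le (α := A) (fun j => v j) (fun j => hv j j.2) μ)
  rw [Fintype.card_coe] at h2
  have h3 := sq_choose_half_mul_le (#A)
  have h4 : (#(A.powerset.filter fun X => ∑ j ∈ X, v j = μ)) ^ 2 * #A ≤ 4 ^ #A :=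
    (Nat.mul_le_mul_right _ (Nat.pow_le_pow_left h2 2)).trans h3
  refine abs_le_of_sq_le_sq' ?_ (by positivity) |>.2
  rw [mul_pow, Real.sq_sqrt (Nat.cast_nonneg _), ← pow_mul, mul_comm (#A) 2, pow_mul]
  norm_num
  exact_mod_cast h4

/-! ### Gaussian small-ball estimates along scales -/

/-- Averaging two shifted Gaussians lowers the peak; comparison with the variance $1+4h^2$ leaves
room for a gain. If $h$ or $yh$ is small, $\cosh u\le e^{u^2/2}$ suffices; otherwise one of the two
Gaussians dominates. -/
theorem cosh_mul_exp_neg_le (y h : ℝ) :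
    (Real.exp (-(y - h) ^ 2 / 2) + Real.exp (-(y + h) ^ 2 / 2)) / 2
      ≤ Real.exp (-(h ^ 2 / (1 + h ^ 2)) / 8) * Real.exp (-y ^ 2 / (2 * (1 + 4 * h ^ 2))) := by
  have hfrac0 : 0 ≤ h ^ 2 / (1 + h ^ 2) := by positivity
  have hfrac1 : h ^ 2 / (1 + h ^ 2) ≤ 1 := by
    rw [div_le_one (by positivity)]; linarith
  have hfrac2 : h ^ 2 / (1 + h ^ 2) ≤ h ^ 2 := div_le_self (by positivity) (by nlinarith)
  have hy2 : y ^ 2 / (2 * (1 + 4 * h ^ 2)) ≤ y ^ 2 / 2 := by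
    apply div_le_div_of_nonneg_left (by positivity) (by positivity)
    nlinarith [sq_nonneg h]
  have hL : (Real.exp (-(y - h) ^ 2 / 2) + Real.exp (-(y + h) ^ 2 / 2)) / 2
      = Real.exp (-(y ^ 2 + h ^ 2) / 2) * Real.cosh (y * h) := by
    rw [Real.cosh_eq, mul_div_assoc', mul_add, ← Real.exp_add, ← Real.exp_add]
    congr 3 <;> ring_nf
  rw [← Real.exp_add]
  by_cases h1 : h ^ 2 ≤ 3 / 4
  · rw [hL]
    calc _ ≤ Real.exp (-(y ^ 2 + h ^ 2) / 2) * Real.exp ((y * h) ^ 2 / 2) := by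
          gcongr; exact Real.cosh_le_exp_half_sq _
      _ ≤ _ := by
          rw [← Real.exp_add]
          apply Real.exp_le_exp.mpr
          have : y ^ 2 / (2 * (1 + 4 * h ^ 2)) ≤ y ^ 2 * (1 - h ^ 2) / 2 := by
            rw [div_le_div_iff₀ (by positivity) (by norm_num)]
            nlinarith [mul_nonneg (sq_nonneg y) (mul_nonneg (sq_nonneg h) (sub_nonneg.mpr h1))]
          simp only [neg_div]
          nlinarith
  · push Not at h1
    by_cases h2 : (y * h) ^ 2 ≤ 1 / 4
    · rw [hL]
      calc _ ≤ Real.exp (-(y ^ 2 + h ^ 2) / 2) * Real.exp ((y * h) ^ 2 / 2) := by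
            gcongr; exact Real.cosh_le_exp_half_sq _
        _ ≤ _ := by
            rw [← Real.exp_add]
            apply Real.exp_le_exp.mpr
            simp only [neg_div]
            linarith
    · push Not at h2
      have hyh : 1 / 2 ≤ |y * h| := by
        by_contra! hlt
        have : (y * h) ^ 2 < (1 / 2) ^ 2 := by
          rw [← sq_abs]; gcongr
        linarith
      have hsum : Real.exp (-(y - h) ^ 2 / 2) + Real.exp (-(y + h) ^ 2 / 2)
          = Real.exp (-(|y| - |h|) ^ 2 / 2) * (1 + Real.exp (-(2 * |y * h|))) := by
        have e : Real.exp (-(|y| - |h|) ^ 2 / 2) * (1 + Real.exp (-(2 * |y * h|)))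
            = Real.exp (-(|y| - |h|) ^ 2 / 2) + Real.exp (-(|y| + |h|) ^ 2 / 2) := by
          rw [mul_add, mul_one, ← Real.exp_add, abs_mul]
          congr 2; ring
        rw [e]
        rcases abs_cases y with ⟨ey, _⟩ | ⟨ey, _⟩ <;> rcases abs_cases h with ⟨eh, _⟩ | ⟨eh, _⟩ <;>
          rw [ey, eh]
        · rw [add_comm]; congr 3 <;> ring
        · rw [add_comm]; congr 3 <;> ring
        · congr 3 <;> ring
      have hb : -(|y| - |h|) ^ 2 / 2 ≤ 1 / 8 + -y ^ 2 / (2 * (1 + 4 * h ^ 2)) := by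
        rw [← sq_abs y, ← sq_abs h]
        generalize |y| = a
        generalize |h| = b
        have : a ^ 2 / (2 * (1 + 4 * b ^ 2)) ≤ 1 / 8 + (a - b) ^ 2 / 2 := by
          rw [div_le_iff₀ (by positivity)]
          nlinarith [sq_nonneg (4 * b * (a - b) - 1 / 2 + 0 * a), sq_nonneg (a - b),
            sq_nonneg (4 * b * (a - b) - 1), sq_nonneg b]
        rw [neg_div, neg_div]
        linarith
      have he1 : Real.exp (-(2 * |y * h|)) ≤ 1 / 2 := by
        calc Real.exp (-(2 * |y * h|)) ≤ Real.exp (-1) := Real.exp_le_exp.mpr (by linarith)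
          _ ≤ 1 / 2 := by
            rw [Real.exp_neg, one_div]
            apply inv_anti₀ (by norm_num)
            have := Real.add_one_le_exp 1
            linarith
      -- The weaker Gaussian is at most half the dominant one, so the average is at most $3/4\le
      -- e^{-1/4}$ of it. Widening costs $1/8$, which leaves the required gain of $1/8$.
      have he2 : (3 : ℝ) / 4 ≤ Real.exp (-(1 / 4)) := by
        have := Real.add_one_le_exp (-(1 / 4) : ℝ)
        linarith
      rw [hsum]
      calc Real.exp (-(|y| - |h|) ^ 2 / 2) * (1 + Real.exp (-(2 * |y * h|))) / 2
          ≤ Real.exp (1 / 8 + -y ^ 2 / (2 * (1 + 4 * h ^ 2))) * Real.exp (-(1 / 4)) := by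
            rw [mul_div_assoc]
            gcongr
            linarith
        _ ≤ _ := by
            rw [← Real.exp_add]
            apply Real.exp_le_exp.mpr
            linarith

/-- Rescale by $\sqrt r$ with $h=b/(2\sqrt r)$, so that $1+4h^2=(r+b^2)/r$. The gain has
$b^2/(4r+b^2)\ge\frac14\,b^2/(r+b^2)$, whence $32=8\cdot4$. -/
theorem avg_gaussian_le {r : ℝ} (hr : 0 < r) (y b : ℝ) :
    (Real.exp (-y ^ 2 / (2 * r)) + Real.exp (-(y + b) ^ 2 / (2 * r))) / 2
      ≤ Real.exp (-(b ^ 2 / (r + b ^ 2)) / 32) *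
        Real.exp (-(y + b / 2) ^ 2 / (2 * (r + b ^ 2))) := by
  have hs : √r ^ 2 = r := Real.sq_sqrt hr.le
  have hs0 : √r ≠ 0 := (Real.sqrt_pos.mpr hr).ne'
  have h := cosh_mul_exp_neg_le ((y + b / 2) / √r) (b / 2 / √r)
  have e1 : -((y + b / 2) / √r - b / 2 / √r) ^ 2 / 2 = -y ^ 2 / (2 * r) := by
    rw [← sub_div, div_pow, hs]; field_simp; ring
  have e2 : -((y + b / 2) / √r + b / 2 / √r) ^ 2 / 2 = -(y + b) ^ 2 / (2 * r) := by
    rw [← add_div, div_pow, hs]; field_simp; ring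
  have e3 : -((y + b / 2) / √r) ^ 2 / (2 * (1 + 4 * (b / 2 / √r) ^ 2))
      = -(y + b / 2) ^ 2 / (2 * (r + b ^ 2)) := by
    rw [div_pow, div_pow, hs]; field_simp; ring
  rw [e1, e2, e3] at h
  refine h.trans (mul_le_mul_of_nonneg_right (Real.exp_le_exp.mpr ?_) (Real.exp_pos _).le)
  rw [div_pow, hs]
  have e4 : b ^ 2 / (r + b ^ 2) / 32 ≤ (b / 2) ^ 2 / r / (1 + (b / 2) ^ 2 / r) / 8 := by
    have : (b / 2) ^ 2 / r / (1 + (b / 2) ^ 2 / r) = b ^ 2 / (4 * r + b ^ 2) := by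
      field_simp; ring
    rw [this]
    have h5 : b ^ 2 / (r + b ^ 2) ≤ 4 * (b ^ 2 / (4 * r + b ^ 2)) := by
      rw [mul_div_assoc', div_le_div_iff₀ (by positivity) (by positivity)]
      nlinarith [mul_nonneg (sq_nonneg b) (sq_nonneg b), sq_nonneg b]
    linarith
  rw [neg_div, neg_div]
  linarith

/-- The number of scales of `v` seen when the coordinates of the list (newest first) are removed
from `S` one after the other. -/
noncomputable def scalePotential {α : Type*} [DecidableEq α] (v : α → ℝ) (S : Finset α) :
    List α → ℝ
  | [] => 0
  -- The denominator is the mass just before `j` is removed, so a fresh `j` in `S` contributes at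
  -- most 1. Once the mass is gone, division by zero makes later terms 0.
  | j :: l => scalePotential v S l + v j ^ 2 / ∑ i ∈ S \ l.toFinset, v i ^ 2

theorem sum_sdiff_toFinset_cons {α : Type*} [DecidableEq α] (f : α → ℝ) {S : Finset α}
    {j : α} {l : List α} (hj : j ∈ S) (hjl : j ∉ l) :
    ∑ i ∈ S \ (j :: l).toFinset, f i + f j = ∑ i ∈ S \ l.toFinset, f i := by
  have : S \ (j :: l).toFinset = (S \ l.toFinset).erase j := by
    ext i; simp only [mem_sdiff, List.mem_toFinset, List.mem_cons, mem_erase]; tauto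
  rw [this, Finset.sum_erase_add]
  simp [hj, hjl]

/-- Average out the newest coordinate first. The variance grows from $r$ to $r+v_j^2$, still at most
the mass before that removal, so each averaging gains the factor given by its term of the potential.
-/
theorem sum_gaussian_le_exp_scalePotential {α : Type*} [DecidableEq α] (v : α → ℝ)
    (S : Finset α) (l : List α) (hl : l.Nodup) (hlS : ∀ j ∈ l, j ∈ S) (r : ℝ) (hr : 0 < r)
    (hrS : r ≤ ∑ i ∈ S \ l.toFinset, v i ^ 2) (y : ℝ) :
    ∑ X ∈ l.toFinset.powerset, Real.exp (-(y + ∑ j ∈ X, v j) ^ 2 / (2 * r))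
      ≤ 2 ^ #l.toFinset * Real.exp (-scalePotential v S l / 32) := by
  induction l generalizing r y with
  | nil =>
    simp only [List.toFinset_nil, powerset_empty, Finset.sum_singleton, Finset.sum_empty,
      card_empty, pow_zero, scalePotential, one_mul]
    apply Real.exp_le_exp.mpr
    rw [neg_div, neg_zero, zero_div]
    have : 0 ≤ (y + 0) ^ 2 / (2 * r) := by positivity
    linarith
  | cons j l ih =>
    rw [List.nodup_cons] at hl
    have hjS : j ∈ S := hlS j (by simp)
    have hjl : j ∉ l.toFinset := by simpa using hl.1
    have hmass := sum_sdiff_toFinset_cons (fun i => v i ^ 2) hjS hl.1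
    have hih := ih hl.2 (fun i hi => hlS i (List.mem_cons_of_mem _ hi)) (r + v j ^ 2)
      (by positivity) (by linarith) (y + v j / 2)
    rw [List.toFinset_cons, Finset.sum_powerset_insert hjl, card_insert_of_notMem hjl,
      ← Finset.sum_add_distrib]
    have hstep : ∀ X ∈ l.toFinset.powerset,
        Real.exp (-(y + ∑ i ∈ X, v i) ^ 2 / (2 * r))
          + Real.exp (-(y + ∑ i ∈ insert j X, v i) ^ 2 / (2 * r))
        ≤ 2 * Real.exp (-(v j ^ 2 / ∑ i ∈ S \ l.toFinset, v i ^ 2) / 32) *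
          Real.exp (-(y + v j / 2 + ∑ i ∈ X, v i) ^ 2 / (2 * (r + v j ^ 2))) := by
      intro X hX
      have hjX : j ∉ X := fun h => hjl (mem_powerset.mp hX h)
      rw [Finset.sum_insert hjX]
      have h := avg_gaussian_le hr (y + ∑ i ∈ X, v i) (v j)
      rw [show y + (v j + ∑ i ∈ X, v i) = y + ∑ i ∈ X, v i + v j by ring,
        show y + v j / 2 + ∑ i ∈ X, v i = y + ∑ i ∈ X, v i + v j / 2 by ring]
      have h2 : Real.exp (-(v j ^ 2 / (r + v j ^ 2)) / 32)
          ≤ Real.exp (-(v j ^ 2 / ∑ i ∈ S \ l.toFinset, v i ^ 2) / 32) := by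
        gcongr
        linarith
      have h3 := h.trans (mul_le_mul_of_nonneg_right h2 (Real.exp_pos _).le)
      linarith
    refine (Finset.sum_le_sum hstep).trans ?_
    rw [← Finset.mul_sum]
    refine (mul_le_mul_of_nonneg_left hih (by positivity)).trans (le_of_eq ?_)
    rw [scalePotential, neg_add, add_div, Real.exp_add, pow_succ]
    ring

/-- The small-ball estimate needs positive remaining mass. Cut back to the last stage that has it:
the removal exhausting the mass adds at most 1 to the potential, and later ones add nothing. -/
theorem scalePotential_suffix {α : Type*} [DecidableEq α] (v : α → ℝ) (S : Finset α)
    (l : List α) (hl : l.Nodup) (hlS : ∀ j ∈ l, j ∈ S) (hpos : 0 < ∑ i ∈ S, v i ^ 2) :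
    ∃ l', l' <:+ l ∧ 0 < ∑ i ∈ S \ l'.toFinset, v i ^ 2 ∧
      scalePotential v S l ≤ scalePotential v S l' + 1 ∧
      (0 < ∑ i ∈ S \ l.toFinset, v i ^ 2 → l' = l) := by
  induction l with
  | nil => exact ⟨[], List.suffix_rfl, by simpa using hpos, by simp, fun _ => rfl⟩
  | cons j l ih =>
    rw [List.nodup_cons] at hl
    have hjS : j ∈ S := hlS j (by simp)
    have hmass := sum_sdiff_toFinset_cons (fun i => v i ^ 2) hjS hl.1
    obtain ⟨l', h1, h2, h3, h4⟩ := ih hl.2 (fun i hi => hlS i (List.mem_cons_of_mem _ hi))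
    have hnn : 0 ≤ ∑ i ∈ S \ (j :: l).toFinset, v i ^ 2 := Finset.sum_nonneg fun _ _ => sq_nonneg _
    rcases hnn.lt_or_eq with hlt | heq
    · exact ⟨j :: l, List.suffix_rfl, hlt, by linarith, fun _ => rfl⟩
    · refine ⟨l', h1.trans (List.suffix_cons _ _), h2, ?_, fun h => absurd h (by rw [← heq]; simp)⟩
      rw [scalePotential]
      by_cases hz : 0 < ∑ i ∈ S \ l.toFinset, v i ^ 2
      · rw [h4 hz]
        have : v j ^ 2 / ∑ i ∈ S \ l.toFinset, v i ^ 2 ≤ 1 := by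
          rw [div_le_one hz]; linarith
        linarith
      · have : ∑ i ∈ S \ l.toFinset, v i ^ 2 = 0 :=
          le_antisymm (not_lt.mp hz) (Finset.sum_nonneg fun _ _ => sq_nonneg _)
        rw [this, div_zero]
        linarith

/-- Small ball estimate for a vector with many scales. -/
theorem card_filter_abs_sum_sub_le {α : Type*} [DecidableEq α] (v : α → ℝ)
    (S : Finset α) (l : List α) (hl : l.Nodup) (hlS : ∀ j ∈ l, j ∈ S)
    (hpos : 0 < ∑ i ∈ S \ l.toFinset, v i ^ 2) (M : ℕ) (μ : ℝ) :
    (#(l.toFinset.powerset.filter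
      fun X => |∑ j ∈ X, v j - μ| ≤ M * √(∑ i ∈ S \ l.toFinset, v i ^ 2)) : ℝ)
      ≤ 2 * (2 * M + 1) * 2 ^ #l.toFinset * Real.exp (-scalePotential v S l / 32) := by
  set r := ∑ i ∈ S \ l.toFinset, v i ^ 2 with hr
  have hs : √r ^ 2 = r := Real.sq_sqrt hpos.le
  have hs0 : 0 < √r := Real.sqrt_pos.mpr hpos
  -- In units of $\sqrt r$, centre Gaussians at the integers $q\in[-M,M]$. The one at the floor of
  -- the deviation is at least $e^{-1/2}\ge 1/2$, hence the factor 2.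
  have hpt : ∀ X ∈ l.toFinset.powerset.filter (fun X => |∑ j ∈ X, v j - μ| ≤ M * √r),
      (1 : ℝ) ≤ ∑ q ∈ Finset.Icc (-(M : ℤ)) M,
        2 * Real.exp (-((-μ - q * √r) + ∑ j ∈ X, v j) ^ 2 / (2 * r)) := by
    intro X hX
    rw [mem_filter] at hX
    set y := ∑ j ∈ X, v j - μ with hy
    have habs : |y / √r| ≤ M := by
      rw [abs_div, abs_of_pos hs0, div_le_iff₀ hs0]; exact hX.2
    rw [abs_le] at habs
    have hq : ⌊y / √r⌋ ∈ Finset.Icc (-(M : ℤ)) M := by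
      rw [Finset.mem_Icc]
      constructor
      · rw [Int.le_floor]; push_cast; exact habs.1
      · have : (⌊y / √r⌋ : ℝ) ≤ M := (Int.floor_le _).trans habs.2
        exact_mod_cast this
    refine le_trans ?_ (Finset.single_le_sum
      (f := fun q : ℤ => 2 * Real.exp (-((-μ - q * √r) + ∑ j ∈ X, v j) ^ 2 / (2 * r)))
      (fun q _ => by positivity) hq)
    have e : (-μ - (⌊y / √r⌋ : ℝ) * √r) + ∑ j ∈ X, v j = Int.fract (y / √r) * √r := by
      rw [Int.fract, sub_mul, div_mul_cancel₀ _ hs0.ne', hy]; ring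
    rw [e, mul_pow, hs, neg_div, mul_div_mul_right _ _ hpos.ne']
    have h0 := Int.fract_nonneg (y / √r)
    have h1 := (Int.fract_lt_one (y / √r)).le
    have h2 : Int.fract (y / √r) ^ 2 ≤ 1 := pow_le_one₀ h0 h1
    have := Real.add_one_le_exp (-(Int.fract (y / √r) ^ 2 / 2))
    linarith
  calc (#(l.toFinset.powerset.filter fun X => |∑ j ∈ X, v j - μ| ≤ M * √r) : ℝ)
      = ∑ X ∈ l.toFinset.powerset.filter (fun X => |∑ j ∈ X, v j - μ| ≤ M * √r), (1 : ℝ) := by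
        simp
    _ ≤ ∑ X ∈ l.toFinset.powerset.filter (fun X => |∑ j ∈ X, v j - μ| ≤ M * √r),
        ∑ q ∈ Finset.Icc (-(M : ℤ)) M,
          2 * Real.exp (-((-μ - q * √r) + ∑ j ∈ X, v j) ^ 2 / (2 * r)) :=
        Finset.sum_le_sum hpt
    _ ≤ ∑ X ∈ l.toFinset.powerset, ∑ q ∈ Finset.Icc (-(M : ℤ)) M,
          2 * Real.exp (-((-μ - q * √r) + ∑ j ∈ X, v j) ^ 2 / (2 * r)) :=
        Finset.sum_le_sum_of_subset_of_nonneg (filter_subset _ _)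
          fun _ _ _ => Finset.sum_nonneg fun _ _ => by positivity
    _ = ∑ q ∈ Finset.Icc (-(M : ℤ)) M, 2 * ∑ X ∈ l.toFinset.powerset,
          Real.exp (-((-μ - q * √r) + ∑ j ∈ X, v j) ^ 2 / (2 * r)) := by
        rw [Finset.sum_comm]
        simp only [Finset.mul_sum]
    _ ≤ ∑ q ∈ Finset.Icc (-(M : ℤ)) M,
          2 * (2 ^ #l.toFinset * Real.exp (-scalePotential v S l / 32)) := by
        refine Finset.sum_le_sum fun q _ => ?_
        gcongr
        exact sum_gaussian_le_exp_scalePotential v S l hl hlS r hpos le_rfl _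
    _ = _ := by
        rw [Finset.sum_const, Int.card_Icc, nsmul_eq_mul]
        have : (((M : ℤ) + 1 - -(M : ℤ)).toNat : ℝ) = 2 * M + 1 := by
          have : ((M : ℤ) + 1 - -(M : ℤ)).toNat = 2 * M + 1 := by omega
          rw [this]; push_cast; ring
        rw [this]; ring

/-! ### Bang's lemma and rounding -/

/-- Bang's lemma. -/
theorem exists_sign_bang {ι : Type*} [Fintype ι] [DecidableEq ι] (H : ι → ι → ℝ)
    (hsymm : ∀ i j, H i j = H j i) (hdiag : ∀ i, H i i = 1) (w : ℝ) (hw : 0 < w) (t : ι → ℝ) :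
    ∃ ε : ι → ℝ, (∀ i, |ε i| = 1) ∧ ∀ i, w ≤ |w * ∑ j, ε j * H i j + t i| := by
  let sg : Bool → ℝ := fun b => if b then 1 else -1
  let f : (ι → Bool) → ℝ := fun ε =>
    w * ∑ i, ∑ j, sg (ε i) * sg (ε j) * H i j + 2 * ∑ i, sg (ε i) * t i
  -- At a maximiser of this quadratic form, flipping the single sign $\varepsilon_i$ cannot increase
  -- it. This is the wanted inequality, with $w$ coming from $H_{ii}=1$.
  obtain ⟨ε, hε⟩ := Finite.exists_max f
  have hsq : ∀ b, sg b * sg b = 1 := by intro b; cases b <;> simp [sg]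
  have hnot : ∀ b, sg (!b) = - sg b := by intro b; cases b <;> simp [sg]
  refine ⟨fun i => sg (ε i), fun i => ?_, fun i => ?_⟩
  · show |sg (ε i)| = 1
    cases ε i <;> simp [sg]
  · have hmax := hε (Function.update ε i (!ε i))
    set s := sg (ε i) with hs
    have hupd : ∀ j, sg (Function.update ε i (!ε i) j)
        = sg (ε j) + (if j = i then -2 * s else 0) := by
      intro j
      by_cases hj : j = i
      · subst hj; simp only [Function.update_self, hnot, if_true]; rw [← hs]; ring
      · simp [hj]
    simp only [f, hupd] at hmax
    have e1 : ∑ a, ∑ b, (sg (ε a) + if a = i then -2 * s else 0) *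
        (sg (ε b) + if b = i then -2 * s else 0) * H a b
        = ∑ a, ∑ b, sg (ε a) * sg (ε b) * H a b - 4 * s * ∑ b, sg (ε b) * H i b
          + 4 * s * s := by
      have : ∀ a b, (sg (ε a) + if a = i then -2 * s else 0) *
        (sg (ε b) + if b = i then -2 * s else 0) * H a b
        = sg (ε a) * sg (ε b) * H a b
          + (if a = i then -2 * s * (sg (ε b) * H a b) else 0)
          + (if b = i then -2 * s * (sg (ε a) * H a b) else 0)
          + (if a = i then (if b = i then 4 * s * s * H a b else 0) else 0) := by
        intro a b
        split_ifs <;> ring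
      simp only [this, Finset.sum_add_distrib]
      rw [Finset.sum_comm (f := fun a b => if a = i then -2 * s * (sg (ε b) * H a b) else 0)]
      simp only [Finset.sum_ite_eq', Finset.mem_univ, if_true]
      have h3 : ∑ x, ∑ x_1, (if x = i then (if x_1 = i then 4 * s * s * H x x_1 else 0) else 0)
          = 4 * s * s := by
        rw [Finset.sum_eq_single i]
        · simp [hdiag]
        · intro b _ hb; simp [hb]
        · simp
      rw [h3]
      simp only [hsymm _ i, ← Finset.mul_sum]
      ring
    have e2 : ∑ a, (sg (ε a) + if a = i then -2 * s else 0) * t a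
        = ∑ a, sg (ε a) * t a - 2 * s * t i := by
      simp only [add_mul, Finset.sum_add_distrib, ite_mul, zero_mul, Finset.sum_ite_eq',
        Finset.mem_univ, if_true]
      ring
    rw [e1, e2] at hmax
    have hss : s * s = 1 := hsq _
    have hkey : w ≤ s * (w * ∑ j, sg (ε j) * H i j + t i) := by
      nlinarith
    have habs : |s| = 1 := by
      rw [hs]; cases ε i <;> simp [sg]
    calc w ≤ s * (w * ∑ j, sg (ε j) * H i j + t i) := hkey
      _ ≤ |s * (w * ∑ j, sg (ε j) * H i j + t i)| := le_abs_self _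
      _ = _ := by rw [abs_mul, habs, one_mul]

/-- Symmetrisation: the moment generating function at $-z$ is at least 1, and the product of those
at $\pm z$ is that of the difference of two independent copies, at most $\cosh z$. -/
theorem bernoulli_mgf_le {p : ℝ} (h0 : 0 ≤ p) (h1 : p ≤ 1) (z : ℝ) :
    p * Real.exp (z * (1 - p)) + (1 - p) * Real.exp (z * (0 - p)) ≤ Real.exp (z ^ 2 / 2) := by
  refine le_trans ?_ (Real.cosh_le_exp_half_sq z)
  set A := p * Real.exp (z * (1 - p)) + (1 - p) * Real.exp (z * (0 - p)) with hA
  set B := p * Real.exp (-(z * (1 - p))) + (1 - p) * Real.exp (-(z * (0 - p))) with hB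
  have hA0 : 0 ≤ A := by
    have : 0 ≤ 1 - p := by linarith
    positivity
  have hB1 : 1 ≤ B := by
    have e1 := Real.add_one_le_exp (-(z * (1 - p)))
    have e2 := Real.add_one_le_exp (-(z * (0 - p)))
    nlinarith
  have hAB : A * B = p ^ 2 + (1 - p) ^ 2 + 2 * p * (1 - p) * Real.cosh z := by
    have e1 : Real.exp (z * (1 - p)) * Real.exp (-(z * (1 - p))) = 1 := by
      rw [← Real.exp_add]; simp
    have e2 : Real.exp (z * (0 - p)) * Real.exp (-(z * (0 - p))) = 1 := by
      rw [← Real.exp_add]; simp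
    have e3 : Real.exp (z * (1 - p)) * Real.exp (-(z * (0 - p))) = Real.exp z := by
      rw [← Real.exp_add]; congr 1; ring
    have e4 : Real.exp (z * (0 - p)) * Real.exp (-(z * (1 - p))) = Real.exp (-z) := by
      rw [← Real.exp_add]; congr 1; ring
    rw [Real.cosh_eq, hA, hB]
    linear_combination p ^ 2 * e1 + (1 - p) ^ 2 * e2 + p * (1 - p) * e3 + p * (1 - p) * e4
  have hc := Real.one_le_cosh z
  calc A ≤ A * B := le_mul_of_one_le_right hA0 hB1
    _ ≤ Real.cosh z := by
      rw [hAB]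
      nlinarith [mul_nonneg h0 (sub_nonneg.mpr h1)]

/-- Rounding a point of the solid cube so that exponential moments stay under control. -/
theorem exists_round_sum_exp_le {α κ : Type*} [DecidableEq α] [Fintype κ] (L : Finset α)
    (u : α → ℝ) (hu : ∀ j ∈ L, 0 ≤ u j ∧ u j ≤ 1) (z : κ → α → ℝ) (c : κ → ℝ)
    (hc : ∀ q, 0 ≤ c q) :
    ∃ Y ⊆ L, ∑ q, c q * Real.exp (∑ j ∈ L, z q j * ((if j ∈ Y then 1 else 0) - u j))
      ≤ ∑ q, c q * Real.exp ((∑ j ∈ L, z q j ^ 2) / 2) := by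
  induction L using Finset.induction_on generalizing c with
  | empty => exact ⟨∅, Finset.Subset.rfl, by simp⟩
  | insert a L ha ih =>
    have hua := hu a (mem_insert_self _ _)
    obtain ⟨Y, hY, hle⟩ := ih (fun j hj => hu j (mem_insert_of_mem hj))
      (fun q => c q * Real.exp (z q a ^ 2 / 2)) (fun q => mul_nonneg (hc q) (Real.exp_pos _).le)
    have haY : a ∉ Y := fun h => ha (hY h)
    set s : κ → ℝ := fun q => ∑ j ∈ L, z q j * ((if j ∈ Y then 1 else 0) - u j) with hs
    have hrhs : ∑ q, c q * Real.exp ((∑ j ∈ insert a L, z q j ^ 2) / 2)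
        = ∑ q, c q * Real.exp (z q a ^ 2 / 2) * Real.exp ((∑ j ∈ L, z q j ^ 2) / 2) := by
      refine Finset.sum_congr rfl fun q _ => ?_
      rw [Finset.sum_insert ha, add_div, Real.exp_add]; ring
    rw [hrhs]
    -- Conditional expectations: rounding coordinate `a` to 1 with probability `u a` meets the bound
    -- on average, so one of the two values does.
    have havg : u a * ∑ q, c q * Real.exp (z q a * (1 - u a) + s q)
        + (1 - u a) * ∑ q, c q * Real.exp (z q a * (0 - u a) + s q)
        ≤ ∑ q, c q * Real.exp (z q a ^ 2 / 2) * Real.exp ((∑ j ∈ L, z q j ^ 2) / 2) := by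
      refine le_trans ?_ hle
      rw [Finset.mul_sum, Finset.mul_sum, ← Finset.sum_add_distrib]
      refine Finset.sum_le_sum fun q _ => ?_
      have h := bernoulli_mgf_le hua.1 hua.2 (z q a)
      rw [Real.exp_add, Real.exp_add]
      have h2 := mul_le_mul_of_nonneg_left h
        (mul_nonneg (hc q) (Real.exp_pos (s q)).le)
      calc _ = c q * Real.exp (s q) * (u a * Real.exp (z q a * (1 - u a)) +
            (1 - u a) * Real.exp (z q a * (0 - u a))) := by ring
        _ ≤ _ := h2
        _ = _ := by ring
    rcases le_total (∑ q, c q * Real.exp (z q a * (1 - u a) + s q))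
      (∑ q, c q * Real.exp (z q a * (0 - u a) + s q)) with hcmp | hcmp
    · refine ⟨insert a Y, insert_subset_insert _ hY,
        le_trans (le_of_eq (b := ∑ q, c q * Real.exp (z q a * (1 - u a) + s q)) ?_)
        (le_trans ?_ havg)⟩
      · refine Finset.sum_congr rfl fun q _ => ?_
        rw [Finset.sum_insert ha, if_pos (mem_insert_self _ _)]
        congr 3
        refine Finset.sum_congr rfl fun j hj => ?_
        have : j ≠ a := fun h => ha (h ▸ hj)
        simp [mem_insert, this]
      · nlinarith
    · refine ⟨Y, hY.trans (subset_insert _ _),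
        le_trans (le_of_eq (b := ∑ q, c q * Real.exp (z q a * (0 - u a) + s q)) ?_)
        (le_trans ?_ havg)⟩
      · refine Finset.sum_congr rfl fun q _ => ?_
        rw [Finset.sum_insert ha, if_neg haY]
      · nlinarith

/-- Avoiding hyperplanes by Bang's lemma followed by rounding. -/
theorem exists_subset_avoiding {α ι : Type*} [DecidableEq α] [DecidableEq ι]
    (L : Finset α) (I : Finset ι) (v : ι → α → ℝ) (m : ι → ℝ) (w : ℝ) (hw : 0 < w)
    (hpos : ∀ i ∈ I, 0 < ∑ j ∈ L, v i j ^ 2)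
    (hcol : ∀ j ∈ L, w * ∑ i ∈ I, |v i j| / √(∑ j ∈ L, v i j ^ 2) ≤ 1 / 2)
    (hI : 2 * (#I : ℝ) < Real.exp (w ^ 2 / 2)) :
    ∃ Y ⊆ L, ∀ i ∈ I, ∑ j ∈ Y, v i j ≠ m i := by
  set ρ : ι → ℝ := fun i => √(∑ j ∈ L, v i j ^ 2) with hρ
  have hρ0 : ∀ i : I, 0 < ρ i := fun i => Real.sqrt_pos.mpr (hpos i i.2)
  have hρ2 : ∀ i : I, ρ i ^ 2 = ∑ j ∈ L, v i j ^ 2 := fun i => Real.sq_sqrt (hpos i i.2).le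
  let e : I → α → ℝ := fun i j => v i j / ρ i
  have hnorm : ∀ i : I, ∑ j ∈ L, e i j ^ 2 = 1 := by
    intro i
    simp only [e, div_pow, ← Finset.sum_div]
    rw [hρ2, div_self (hpos i i.2).ne']
  obtain ⟨ε, hε, hbang⟩ := exists_sign_bang (fun i j : I => ∑ a ∈ L, e i a * e j a)
    (fun i j => Finset.sum_congr rfl fun a _ => mul_comm _ _)
    (fun i => by rw [← hnorm i]; exact Finset.sum_congr rfl fun a _ => (sq _).symm) w hw
    (fun i => ∑ a ∈ L, e i a * (1 / 2) - m i / ρ i)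
  -- Bang's lemma for the Gram matrix of the unit rows, with offsets measured from the centre
  -- $(1/2,\dots,1/2)$, puts `u` at distance at least `w` from every hyperplane. The column
  -- condition keeps it in the solid cube.
  let u : α → ℝ := fun a => 1 / 2 + w * ∑ i : I, ε i * e i a
  have hu : ∀ a ∈ L, 0 ≤ u a ∧ u a ≤ 1 := by
    intro a ha
    have h1 : |w * ∑ i : I, ε i * e i a| ≤ 1 / 2 := by
      rw [abs_mul, abs_of_pos hw]
      refine le_trans (mul_le_mul_of_nonneg_left ?_ hw.le) (hcol a ha)
      rw [← Finset.sum_coe_sort I (fun i => |v i a| / √(∑ j ∈ L, v i j ^ 2))]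
      refine (Finset.abs_sum_le_sum_abs _ _).trans (le_of_eq ?_)
      refine Finset.sum_congr rfl fun i _ => ?_
      rw [abs_mul, hε, one_mul, abs_div, abs_of_pos (hρ0 i)]
    rw [abs_le] at h1
    simp only [u]
    constructor <;> linarith
  have hfar : ∀ i : I, w ≤ |∑ a ∈ L, e i a * u a - m i / ρ i| := by
    intro i
    refine (hbang i).trans (le_of_eq ?_)
    congr 1
    have h1 : w * ∑ j, ε j * ∑ a ∈ L, e i a * e j a
        = ∑ a ∈ L, e i a * (w * ∑ j, ε j * e j a) := by
      simp only [Finset.mul_sum]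
      rw [Finset.sum_comm]
      exact Finset.sum_congr rfl fun a _ => Finset.sum_congr rfl fun j _ => by ring
    simp only [u, mul_add, Finset.sum_add_distrib]
    rw [h1]
    ring
  -- Hitting hyperplane $i$ would move the normalised form by at least $w$, so one of the
  -- exponentials with sign $\pm w$ would reach $e^{w^2}$. Their total is at most
  -- $2|I|e^{w^2/2}<e^{w^2}$.
  obtain ⟨Y, hY, hle⟩ := exists_round_sum_exp_le (κ := I × Bool) L u hu
    (fun q a => (if q.2 then w else -w) * e q.1 a) (fun _ => 1) (fun _ => zero_le_one)
  refine ⟨Y, hY, fun i hi heq => ?_⟩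
  have hrhs : ∀ q : I × Bool,
      (∑ j ∈ L, ((if q.2 then w else -w) * e q.1 j) ^ 2) = w ^ 2 := by
    rintro ⟨q, b⟩
    simp only [mul_pow, ← Finset.mul_sum, hnorm]
    cases b <;> simp
  simp only [hrhs, one_mul, Finset.sum_const, card_univ, Fintype.card_prod, Fintype.card_coe,
    Fintype.card_bool, nsmul_eq_mul] at hle
  let i' : I := ⟨i, hi⟩
  have hdev : w ≤ |∑ a ∈ L, e i' a * ((if a ∈ Y then 1 else 0) - u a)| := by
    have h1 : ∑ a ∈ L, e i' a * ((if a ∈ Y then 1 else 0) - u a)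
        = m i / ρ i - ∑ a ∈ L, e i' a * u a := by
      simp only [mul_sub, Finset.sum_sub_distrib]
      congr 1
      simp only [mul_ite, mul_one, mul_zero]
      rw [← Finset.sum_filter, Finset.filter_mem_eq_inter, inter_eq_right.mpr hY, ← heq,
        Finset.sum_div]
    rw [h1, abs_sub_comm]
    exact hfar i'
  have hbig : ∃ b : Bool, Real.exp (w ^ 2) ≤
      Real.exp (∑ a ∈ L, (if b then w else -w) * e i' a * ((if a ∈ Y then 1 else 0) - u a)) := by
    rcases le_abs'.mp hdev with h | h
    · refine ⟨false, Real.exp_le_exp.mpr ?_⟩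
      simp only [Bool.false_eq_true, if_false, mul_assoc, ← Finset.mul_sum]
      nlinarith
    · refine ⟨true, Real.exp_le_exp.mpr ?_⟩
      simp only [if_true, mul_assoc, ← Finset.mul_sum]
      nlinarith
  obtain ⟨b, hb⟩ := hbig
  have hsingle := Finset.single_le_sum (s := univ) (a := ((i', b) : I × Bool))
    (f := fun q : I × Bool => Real.exp (∑ a ∈ L, (if q.2 then w else -w) * e q.1 a *
      ((if a ∈ Y then 1 else 0) - u a))) (fun q _ => (Real.exp_pos _).le) (mem_univ _)
  have htot := hb.trans (hsingle.trans hle)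
  have hsplit : Real.exp (w ^ 2) = Real.exp (w ^ 2 / 2) * Real.exp (w ^ 2 / 2) := by
    rw [← Real.exp_add]; congr 1; ring
  rw [hsplit] at htot
  have := le_of_mul_le_mul_right htot (Real.exp_pos _)
  push_cast at this
  linarith

/-! ### Greedy column removal and avoidance of all rows -/

/-- Greedily removing columns that are heavy for the rows with few scales stops early. -/
theorem exists_saturated_list {α ι : Type*} [DecidableEq α] [Fintype ι] [DecidableEq ι]
    (v : ι → α → ℝ) (S : Finset α) {R δ d : ℝ} (hδ : 0 ≤ δ)
    (hR : 0 ≤ R) (hd : 0 ≤ d) (hdeg : ∀ j ∈ S, (#{i | v i j ≠ 0} : ℝ) ≤ d) :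
    ∃ l : List α, l.Nodup ∧ (∀ j ∈ l, j ∈ S) ∧
      (l.length : ℝ) * δ ^ 2 ≤ d * (Fintype.card ι * (R + 1)) ∧
      ∀ j ∈ S \ l.toFinset, ∑ i with scalePotential (v i) S l < R ∧
        0 < ∑ a ∈ S \ l.toFinset, v i a ^ 2,
          |v i j| / √(∑ a ∈ S \ l.toFinset, v i a ^ 2) ≤ δ := by
  -- Otherwise removal never stops and the list outgrows `S`. The potentials, capped at $R+1$, pay
  -- for the length.
  by_contra! hno
  have hchain : ∀ N : ℕ, ∃ l : List α, l.length = N ∧ l.Nodup ∧ (∀ j ∈ l, j ∈ S) ∧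
      (l.length : ℝ) * δ ^ 2 ≤ d * ∑ i, min (scalePotential (v i) S l) (R + 1) := by
    intro N
    induction N with
    | zero =>
      refine ⟨[], rfl, List.nodup_nil, by simp, ?_⟩
      simp only [List.length_nil, Nat.cast_zero, zero_mul, scalePotential]
      rw [min_eq_left (by linarith)]
      simp
    | succ N ih =>
      obtain ⟨l, hlN, hl, hlS, hle⟩ := ih
      have hbound : (l.length : ℝ) * δ ^ 2 ≤ d * (Fintype.card ι * (R + 1)) := by
        refine hle.trans (mul_le_mul_of_nonneg_left ?_ hd)
        rw [← nsmul_eq_mul, ← Finset.card_univ, ← Finset.sum_const]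
        exact Finset.sum_le_sum fun i _ => min_le_right _ _
      obtain ⟨j, hj, hbad⟩ := hno l hl hlS hbound
      rw [mem_sdiff, List.mem_toFinset] at hj
      refine ⟨j :: l, by simp [hlN], List.nodup_cons.mpr ⟨hj.2, hl⟩, ?_, ?_⟩
      · intro a ha
        rcases List.mem_cons.mp ha with rfl | ha
        · exact hj.1
        · exact hlS a ha
      set M : ι → ℝ := fun i => ∑ a ∈ S \ l.toFinset, v i a ^ 2 with hM
      set I : Finset ι := univ.filter fun i => scalePotential (v i) S l < R ∧ 0 < M i with hI
      -- A row with potential below $R$ gains at most 1, so the cap $R+1$ truncates nothing.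
      have hinc : ∀ i, min (scalePotential (v i) S l) (R + 1)
          + (if i ∈ I then v i j ^ 2 / M i else 0)
          ≤ min (scalePotential (v i) S (j :: l)) (R + 1) := by
        intro i
        have hMi : 0 ≤ M i := Finset.sum_nonneg fun _ _ => sq_nonneg _
        have hnn : 0 ≤ v i j ^ 2 / M i := by positivity
        have hpot : scalePotential (v i) S (j :: l) = scalePotential (v i) S l + v i j ^ 2 / M i :=
          rfl
        rw [hpot]
        split_ifs with hi
        · rw [hI, mem_filter] at hi
          have h1 : v i j ^ 2 / M i ≤ 1 := by
            rw [div_le_one hi.2.2]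
            exact Finset.single_le_sum (f := fun a => v i a ^ 2) (fun _ _ => sq_nonneg _)
              (by simp [hj])
          rw [min_eq_left (by linarith [hi.2.1]), min_eq_left (by linarith [hi.2.1])]
        · rw [add_zero]
          exact min_le_min_right _ (by linarith)
      have hsum : ∑ i, min (scalePotential (v i) S l) (R + 1) + ∑ i ∈ I, v i j ^ 2 / M i
          ≤ ∑ i, min (scalePotential (v i) S (j :: l)) (R + 1) := by
        have h1 : ∑ i ∈ I, v i j ^ 2 / M i = ∑ i, if i ∈ I then v i j ^ 2 / M i else 0 := by
          rw [Finset.sum_ite_mem, univ_inter]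
        rw [h1, ← Finset.sum_add_distrib]
        exact Finset.sum_le_sum fun i _ => hinc i
      -- Cauchy–Schwarz over the at most `d` rows meeting column `j`.
      have hcs : δ ^ 2 ≤ d * ∑ i ∈ I, v i j ^ 2 / M i := by
        have h1 : ∑ i ∈ I, |v i j| / √(M i)
            = ∑ i ∈ I.filter (fun i => v i j ≠ 0), |v i j| / √(M i) := by
          refine (Finset.sum_filter_of_ne ?_).symm
          intro i _ hne h0
          exact hne (by simp [h0])
        have h2 := sq_sum_le_card_mul_sum_sq (s := I.filter (fun i => v i j ≠ 0))
          (f := fun i => |v i j| / √(M i))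
        rw [← h1] at h2
        have h3 : ∑ i ∈ I.filter (fun i => v i j ≠ 0), (|v i j| / √(M i)) ^ 2
            ≤ ∑ i ∈ I, v i j ^ 2 / M i := by
          refine (Finset.sum_le_sum_of_subset_of_nonneg (filter_subset _ _)
            fun _ _ _ => sq_nonneg _).trans (le_of_eq ?_)
          refine Finset.sum_congr rfl fun i hi => ?_
          rw [hI, mem_filter] at hi
          rw [div_pow, sq_abs, Real.sq_sqrt hi.2.2.le]
        have h4 : (#(I.filter fun i => v i j ≠ 0) : ℝ) ≤ d := by
          refine le_trans ?_ (hdeg j hj.1)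
          exact_mod_cast card_le_card (filter_subset_filter _ (subset_univ _))
        have h5 : 0 ≤ ∑ i ∈ I.filter (fun i => v i j ≠ 0), (|v i j| / √(M i)) ^ 2 :=
          Finset.sum_nonneg fun _ _ => sq_nonneg _
        calc δ ^ 2 ≤ (∑ i ∈ I, |v i j| / √(M i)) ^ 2 := by gcongr
          _ ≤ _ := h2
          _ ≤ d * ∑ i ∈ I.filter (fun i => v i j ≠ 0), (|v i j| / √(M i)) ^ 2 :=
            mul_le_mul_of_nonneg_right h4 h5
          _ ≤ _ := mul_le_mul_of_nonneg_left h3 hd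
      have := mul_le_mul_of_nonneg_left hsum hd
      rw [List.length_cons, Nat.cast_succ]
      linarith
  obtain ⟨l, hlen, hl, hlS, -⟩ := hchain (#S + 1)
  have h1 : #l.toFinset ≤ #S := card_le_card fun j hj => hlS j (by simpa using hj)
  rw [List.toFinset_card_of_nodup hl] at h1
  omega

theorem sum_abs_le_sqrt_mul_sqrt {α : Type*} [DecidableEq α] (v : α → ℝ) (T : Finset α) {s : ℝ}
    (hs : (#(T.filter fun j => v j ≠ 0) : ℝ) ≤ s ^ 2) (hs0 : 0 ≤ s) :
    ∑ j ∈ T, |v j| ≤ s * √(∑ j ∈ T, v j ^ 2) := by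
  have h1 : ∑ j ∈ T, |v j| = ∑ j ∈ T.filter (fun j => v j ≠ 0), |v j| := by
    rw [Finset.sum_filter_of_ne]
    intro j _ hne h0
    exact hne (by simp [h0])
  have h2 := sq_sum_le_card_mul_sum_sq (s := T.filter (fun j => v j ≠ 0)) (f := fun j => |v j|)
  have h3 : ∑ j ∈ T.filter (fun j => v j ≠ 0), |v j| ^ 2 ≤ ∑ j ∈ T, v j ^ 2 := by
    simp only [sq_abs]
    exact Finset.sum_le_sum_of_subset_of_nonneg (filter_subset _ _) fun _ _ _ => sq_nonneg _
  rw [h1]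
  refine abs_le_of_sq_le_sq' ?_ (by positivity) |>.2
  rw [mul_pow, Real.sq_sqrt (Finset.sum_nonneg fun _ _ => sq_nonneg _)]
  refine h2.trans ?_
  gcongr

/-- A matrix with sparse rows, sparse columns and expanding rows can avoid any right-hand side:
some cube vertex supported on `S` misses all hyperplanes that meet `S`. -/
theorem exists_subset_sum_ne {α ι : Type*} [DecidableEq α] [Fintype ι] [DecidableEq ι]
    (v : ι → α → ℝ) (m : ι → ℝ) (S : Finset α) {R d w Λ s : ℝ} (hw : 0 < w) (hR0 : 0 ≤ R)
    (hd : 0 ≤ d) (hΛ : 0 < Λ) (M : ℕ) (hs0 : 0 ≤ s) (hsM : s ≤ M)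
    (hdeg : ∀ j ∈ S, (#{i | v i j ≠ 0} : ℝ) ≤ d)
    (hrow : ∀ i, (#{j ∈ S | v i j ≠ 0} : ℝ) ≤ s ^ 2)
    (hexp : ∀ E : Finset ι, E.Nonempty → (∀ i ∈ E, ∃ j ∈ S, v i j ≠ 0) →
      Λ * #E ≤ #{j ∈ S | ∃ i ∈ E, v i j ≠ 0})
    (hwk : 2 * (Fintype.card ι : ℝ) < Real.exp (w ^ 2 / 2))
    (hRk : 4 * (2 * M + 1) * Real.exp (-(R - 1) / 32) * Fintype.card ι ≤ 1)
    (hnum : 8 * w ^ 2 * (d * (Fintype.card ι * (R + 1))) < Λ * √Λ) :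
    ∃ Z ⊆ S, ∀ i, (∃ j ∈ S, v i j ≠ 0) → ∑ j ∈ Z, v i j ≠ m i := by
  -- The threshold $\delta=1/(2w)$ is what Bang's lemma needs to stay in the solid cube.
  obtain ⟨l, hl, hlS, hlen, hcol⟩ := exists_saturated_list v S (R := R) (δ := 1 / (2 * w))
    (d := d) (by positivity) hR0 hd hdeg
  set K := l.toFinset with hK
  have hKS : K ⊆ S := fun j hj => hlS j (by simpa [hK] using hj)
  set P : ι → ℝ := fun i => scalePotential (v i) S l with hP
  set Q : ι → ℝ := fun i => ∑ a ∈ S \ K, v i a ^ 2 with hQ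
  have hQ0 : ∀ i, 0 ≤ Q i := fun i => Finset.sum_nonneg fun _ _ => sq_nonneg _
  set D : Finset ι := univ.filter fun i => R ≤ P i ∧ ∃ j ∈ S, v i j ≠ 0 with hD
  set E : Finset ι := univ.filter fun i => Q i = 0 ∧ ∃ j ∈ S, v i j ≠ 0 with hE
  have hsuf : ∀ i, ∃ l', l' <:+ l ∧ (i ∈ D → 0 < ∑ a ∈ S \ l'.toFinset, v i a ^ 2 ∧
      R - 1 ≤ scalePotential (v i) S l') := by
    intro i
    by_cases hi : i ∈ D
    · have hi' := (mem_filter.mp hi).2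
      obtain ⟨j, hj, hne⟩ := hi'.2
      obtain ⟨l', h1, h2, h3, -⟩ := scalePotential_suffix (v i) S l hl hlS
        (Finset.sum_pos' (fun _ _ => sq_nonneg _) ⟨j, hj, by positivity⟩)
      exact ⟨l', h1, fun _ => ⟨h2, by linarith [hi'.1]⟩⟩
    · exact ⟨l, List.suffix_rfl, fun h => absurd h hi⟩
  choose l' hl'suf hl' using hsuf
  have hl'K : ∀ i, (l' i).toFinset ⊆ K := fun i j hj => by
    rw [hK, List.mem_toFinset]
    exact (hl'suf i).subset (by simpa using hj)
  have hsuppK : ∀ i ∈ E, (S.filter fun j => v i j ≠ 0) ⊆ K := by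
    intro i hi j hj
    rw [mem_filter] at hj
    by_contra hjK
    have hz := (mem_filter.mp hi).2.1
    rw [hQ, Finset.sum_eq_zero_iff_of_nonneg (fun _ _ => sq_nonneg _)] at hz
    have := hz j (mem_sdiff.mpr ⟨hj.1, hjK⟩)
    exact hj.2 (by simpa using this)
  let badE : ι → Finset (Finset α) := fun i => K.powerset.filter fun X =>
    ∑ j ∈ X ∩ S.filter (fun j => v i j ≠ 0), v i j = m i
  -- The columns outside `l' i` move row $i$ by at most $s\le M$ times the root of the remaining
  -- mass. Outside this event no later choice can reach the target.
  let badD : ι → Finset (Finset α) := fun i => K.powerset.filter fun X =>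
    |∑ j ∈ X ∩ (l' i).toFinset, v i j - m i| ≤ M * √(∑ a ∈ S \ (l' i).toFinset, v i a ^ 2)
  have hsplit : ∀ A ⊆ K, (2 : ℝ) ^ #(K \ A) * 2 ^ #A = 2 ^ #K := by
    intro A hA
    rw [← pow_add, card_sdiff_add_card_eq_card hA]
  have hbadE : ∀ i ∈ E, (#(badE i) : ℝ) * √Λ ≤ 2 ^ #K := by
    intro i hi
    set A := S.filter (fun j => v i j ≠ 0) with hA
    have h1 := card_powerset_filter_inter (hsuppK i hi) fun X => ∑ j ∈ X, v i j = m i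
    have h2 := card_powerset_filter_sum_eq_le (A := A) (v i)
      (fun j hj => (mem_filter.mp hj).2) (m i)
    have hfat : Λ ≤ #A := by
      have := hexp {i} (singleton_nonempty i)
        (fun q hq => by rw [mem_singleton.mp hq]; exact (mem_filter.mp hi).2.2)
      simpa using this
    have h3 : (#(badE i) : ℝ) = 2 ^ #(K \ A) *
        #(A.powerset.filter fun X => ∑ j ∈ X, v i j = m i) := by exact_mod_cast h1
    calc (#(badE i) : ℝ) * √Λ ≤ #(badE i) * √(#A : ℝ) := by gcongr
      _ = 2 ^ #(K \ A) * (#(A.powerset.filter fun X => ∑ j ∈ X, v i j = m i) * √(#A : ℝ)) := by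
        rw [h3]; ring
      _ ≤ 2 ^ #(K \ A) * 2 ^ #A := by gcongr
      _ = 2 ^ #K := hsplit A (hsuppK i hi)
  have hbadD : ∀ i ∈ D, (#(badD i) : ℝ) ≤
      2 * (2 * M + 1) * Real.exp (-(R - 1) / 32) * 2 ^ #K := by
    intro i hi
    set A := (l' i).toFinset with hA
    have h1 := card_powerset_filter_inter (hl'K i) fun X =>
      |∑ j ∈ X, v i j - m i| ≤ M * √(∑ a ∈ S \ A, v i a ^ 2)
    have h2 := card_filter_abs_sum_sub_le (v i) S (l' i) (hl.sublist (hl'suf i).sublist)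
      (fun j hj => hlS j ((hl'suf i).subset hj)) (hl' i hi).1 M (m i)
    have h3 : (#(badD i) : ℝ) = 2 ^ #(K \ A) * #(A.powerset.filter fun X =>
        |∑ j ∈ X, v i j - m i| ≤ M * √(∑ a ∈ S \ A, v i a ^ 2)) := by exact_mod_cast h1
    rw [h3]
    calc _ ≤ 2 ^ #(K \ A) * (2 * (2 * M + 1) * 2 ^ #A *
          Real.exp (-scalePotential (v i) S (l' i) / 32)) := by gcongr
      _ ≤ 2 ^ #(K \ A) * (2 * (2 * M + 1) * 2 ^ #A * Real.exp (-(R - 1) / 32)) := by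
        gcongr
        exact (hl' i hi).2
      _ = 2 * (2 * M + 1) * Real.exp (-(R - 1) / 32) * (2 ^ #(K \ A) * 2 ^ #A) := by ring
      _ = _ := by rw [hsplit A (hl'K i)]
  -- Rows of `E` live inside `K`, so expansion gives $\Lambda|E|\le|K|$, and the greedy bound on
  -- $|K|$ is below $\Lambda\sqrt\Lambda/2$.
  have hEcard : 2 * (#E : ℝ) < √Λ := by
    have hsq : 0 < √Λ := Real.sqrt_pos.mpr hΛ
    rcases E.eq_empty_or_nonempty with h0 | hne
    · rw [h0]; simpa using hsq
    have h1 := hexp E hne fun i hi => (mem_filter.mp hi).2.2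
    have h2 : (#{j ∈ S | ∃ i ∈ E, v i j ≠ 0} : ℝ) ≤ l.length := by
      rw [← List.toFinset_card_of_nodup hl]
      have : (S.filter fun j => ∃ i ∈ E, v i j ≠ 0) ⊆ K := by
        intro j hj
        rw [mem_filter] at hj
        obtain ⟨hjS, i, hi, hne⟩ := hj
        exact hsuppK i hi (mem_filter.mpr ⟨hjS, hne⟩)
      exact_mod_cast card_le_card this
    have h3 : (l.length : ℝ) ≤ 4 * w ^ 2 * (d * (Fintype.card ι * (R + 1))) := by
      have : (l.length : ℝ) = 4 * w ^ 2 * (l.length * (1 / (2 * w)) ^ 2) := by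
        field_simp; ring
      rw [this]
      gcongr
    have h4 : Λ * (2 * #E) < Λ * √Λ := by linarith
    exact lt_of_mul_lt_mul_left h4 hΛ.le
  have hpow : (0 : ℝ) < 2 ^ #K := by positivity
  have htotE : 2 * (#(E.biUnion badE) : ℝ) < 2 ^ #K := by
    have hsq : 0 < √Λ := Real.sqrt_pos.mpr hΛ
    have h1 : (#(E.biUnion badE) : ℝ) ≤ ∑ i ∈ E, (#(badE i) : ℝ) := by
      exact_mod_cast card_biUnion_le
    have h2 : (∑ i ∈ E, (#(badE i) : ℝ)) * √Λ ≤ #E * 2 ^ #K := by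
      rw [Finset.sum_mul, ← nsmul_eq_mul, ← Finset.sum_const]
      exact Finset.sum_le_sum hbadE
    have h3 : 2 * (#(E.biUnion badE) : ℝ) * √Λ < 2 ^ #K * √Λ := by
      calc 2 * (#(E.biUnion badE) : ℝ) * √Λ ≤ 2 * ((∑ i ∈ E, (#(badE i) : ℝ)) * √Λ) := by
            rw [mul_assoc]; gcongr
        _ ≤ (2 * #E) * 2 ^ #K := by linarith
        _ < √Λ * 2 ^ #K := by gcongr
        _ = _ := mul_comm _ _
    exact lt_of_mul_lt_mul_right h3 hsq.le
  have htotD : 2 * (#(D.biUnion badD) : ℝ) ≤ 2 ^ #K := by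
    have h1 : (#(D.biUnion badD) : ℝ) ≤ ∑ i ∈ D, (#(badD i) : ℝ) := by
      exact_mod_cast card_biUnion_le
    have h2 : ∑ i ∈ D, (#(badD i) : ℝ) ≤
        #D * (2 * (2 * M + 1) * Real.exp (-(R - 1) / 32) * 2 ^ #K) := by
      rw [← nsmul_eq_mul, ← Finset.sum_const]
      exact Finset.sum_le_sum hbadD
    have h3 : (#D : ℝ) ≤ Fintype.card ι := by exact_mod_cast card_le_univ D
    calc 2 * (#(D.biUnion badD) : ℝ)
        ≤ 2 * (#D * (2 * (2 * M + 1) * Real.exp (-(R - 1) / 32) * 2 ^ #K)) := by linarith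
      _ ≤ 2 * (Fintype.card ι * (2 * (2 * M + 1) * Real.exp (-(R - 1) / 32) * 2 ^ #K)) := by
        gcongr
      _ = (4 * (2 * M + 1) * Real.exp (-(R - 1) / 32) * Fintype.card ι) * 2 ^ #K := by ring
      _ ≤ 1 * 2 ^ #K := by gcongr
      _ = _ := one_mul _
  obtain ⟨X, hX, hXbad⟩ : ∃ X ∈ K.powerset, X ∉ E.biUnion badE ∪ D.biUnion badD := by
    apply exists_mem_notMem_of_card_lt_card
    rw [card_powerset]
    refine (card_union_le _ _).trans_lt ?_
    have : (#(E.biUnion badE) : ℝ) + #(D.biUnion badD) < 2 ^ #K := by linarith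
    exact_mod_cast this
  have hXK := mem_powerset.mp hX
  simp only [mem_union, mem_biUnion, not_or, not_exists, not_and] at hXbad
  set I : Finset ι := univ.filter fun i => P i < R ∧ 0 < Q i with hI
  have hcol' : ∀ j ∈ S \ K, w * ∑ i ∈ I, |v i j| / √(∑ a ∈ S \ K, v i a ^ 2) ≤ 1 / 2 := by
    intro j hj
    calc _ ≤ w * (1 / (2 * w)) := mul_le_mul_of_nonneg_left (hcol j hj) hw.le
      _ = 1 / 2 := by field_simp
  have hIw : 2 * (#I : ℝ) < Real.exp (w ^ 2 / 2) := by
    refine lt_of_le_of_lt ?_ hwk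
    have : (#I : ℝ) ≤ Fintype.card ι := by exact_mod_cast card_le_univ I
    linarith
  obtain ⟨Y, hY, hYI⟩ := exists_subset_avoiding (S \ K) I v (fun i => m i - ∑ j ∈ X, v i j) w hw
    (fun i hi => (mem_filter.mp hi).2.2) hcol' hIw
  have hXY : Disjoint X Y := by
    refine disjoint_of_subset_left hXK (disjoint_of_subset_right hY ?_)
    exact disjoint_sdiff
  have hZS : X ∪ Y ⊆ S := union_subset (hXK.trans hKS) (hY.trans sdiff_subset)
  refine ⟨X ∪ Y, hZS, fun i hi heq => ?_⟩
  rcases lt_or_ge (P i) R with hPR | hPR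
  · rcases (hQ0 i).lt_or_eq with hpos | hzero
    · refine hYI i (mem_filter.mpr ⟨mem_univ i, hPR, hpos⟩) ?_
      rw [Finset.sum_union hXY] at heq
      linarith
    · have hiE : i ∈ E := mem_filter.mpr ⟨mem_univ i, hzero.symm, hi⟩
      refine hXbad.1 i hiE (mem_filter.mpr ⟨hX, ?_⟩)
      rw [← heq]
      refine Finset.sum_subset (inter_subset_left.trans subset_union_left) fun j hj hj' => ?_
      by_contra hne
      have hjA : j ∈ S.filter fun j => v i j ≠ 0 := mem_filter.mpr ⟨hZS hj, hne⟩
      have hjK := hsuppK i hiE hjA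
      have hjX : j ∈ X := (mem_union.mp hj).resolve_right
        fun h => (mem_sdiff.mp (hY h)).2 hjK
      exact hj' (mem_inter.mpr ⟨hjX, hjA⟩)
  · have hiD : i ∈ D := mem_filter.mpr ⟨mem_univ i, hPR, hi⟩
    refine hXbad.2 i hiD (mem_filter.mpr ⟨hX, ?_⟩)
    set A := (l' i).toFinset with hA
    have hXA : X ∩ A = (X ∪ Y) ∩ A := by
      ext j
      simp only [mem_inter, mem_union]
      constructor
      · tauto
      · rintro ⟨h1 | h1, h2⟩
        · exact ⟨h1, h2⟩
        · exact absurd (hl'K i h2) (mem_sdiff.mp (hY h1)).2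
    have h1 : ∑ j ∈ X ∩ A, v i j - m i = - ∑ j ∈ (X ∪ Y) \ A, v i j := by
      rw [hXA, ← heq, ← Finset.sum_inter_add_sum_sdiff (X ∪ Y) A]; ring
    rw [h1, abs_neg]
    calc |∑ j ∈ (X ∪ Y) \ A, v i j| ≤ ∑ j ∈ (X ∪ Y) \ A, |v i j| := abs_sum_le_sum_abs _ _
      _ ≤ ∑ j ∈ S \ A, |v i j| :=
        Finset.sum_le_sum_of_subset_of_nonneg (sdiff_subset_sdiff hZS le_rfl)
          fun _ _ _ => abs_nonneg _
      _ ≤ s * √(∑ a ∈ S \ A, v i a ^ 2) := by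
        refine sum_abs_le_sqrt_mul_sqrt _ _ (le_trans ?_ (hrow i)) hs0
        exact_mod_cast card_le_card (filter_subset_filter _ sdiff_subset)
      _ ≤ _ := by gcongr

/-! ### Choice of the column set -/

/-- Combinatorial selection of a nonempty set of sparse columns on which the rows expand. -/
theorem exists_expanding_columns {n k : ℕ} (v : Fin k → Fin n → ℝ) (hn : 0 < n) (hk : 0 < k)
    (hrow : ∀ i, #{j | v i j ≠ 0} ≤ 2 * k) :
    ∃ S : Finset (Fin n), S.Nonempty ∧
      (∀ j ∈ S, (#{i | v i j ≠ 0} : ℝ) ≤ 4 * k ^ 2 / n) ∧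
      ∀ E : Finset (Fin k), E.Nonempty → (∀ i ∈ E, ∃ j ∈ S, v i j ≠ 0) →
        (n / (4 * k) : ℝ) * #E ≤ #{j ∈ S | ∃ i ∈ E, v i j ≠ 0} := by
  have hn' : (0 : ℝ) < n := by exact_mod_cast hn
  have hk' : (0 : ℝ) < k := by exact_mod_cast hk
  set d : ℝ := 4 * k ^ 2 / n with hd
  have hd0 : 0 < d := by positivity
  set Λ : ℝ := n / (4 * k) with hΛ
  have hΛ0 : 0 < Λ := by positivity
  -- There are at most $2k^2$ nonzero entries, so at most $2k^2/d=n/2$ columns exceed degree $d$.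
  set S₀ : Finset (Fin n) := univ.filter fun j => (#{i | v i j ≠ 0} : ℝ) ≤ d with hS₀
  have hS₀card : (n : ℝ) / 2 ≤ #S₀ := by
    have h1 : ∑ j, #{i | v i j ≠ 0} = ∑ i, #{j | v i j ≠ 0} := by
      simp only [card_filter]
      exact Finset.sum_comm
    have h2 : ∑ i, #{j | v i j ≠ 0} ≤ k * (2 * k) := by
      refine (Finset.sum_le_sum fun i _ => hrow i).trans ?_
      simp
    have h3 : (#(univ \ S₀) : ℝ) * d ≤ ∑ j, (#{i | v i j ≠ 0} : ℝ) := by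
      rw [← nsmul_eq_mul, ← Finset.sum_const]
      refine (Finset.sum_le_sum (g := fun j => (#{i | v i j ≠ 0} : ℝ)) fun j hj => ?_).trans
        (Finset.sum_le_sum_of_subset_of_nonneg (subset_univ _) fun _ _ _ => Nat.cast_nonneg _)
      simp only [hS₀, mem_sdiff, mem_univ, mem_filter, true_and, not_le] at hj
      exact hj.le
    have h4 : ∑ j, (#{i | v i j ≠ 0} : ℝ) ≤ 2 * k ^ 2 := by
      have : ∑ j, #{i | v i j ≠ 0} ≤ k * (2 * k) := h1 ▸ h2
      have : (∑ j, (#{i | v i j ≠ 0} : ℝ)) ≤ k * (2 * k) := by exact_mod_cast this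
      linarith
    have h5 : (#(univ \ S₀) : ℝ) + #S₀ = n := by
      have := card_sdiff_add_card_eq_card (subset_univ S₀)
      rw [card_univ, Fintype.card_fin] at this
      exact_mod_cast this
    have h6 : (#(univ \ S₀) : ℝ) ≤ n / 2 := by
      have h7 : (#(univ \ S₀) : ℝ) * d ≤ n / 2 * d := by
        have : (n : ℝ) / 2 * d = 2 * k ^ 2 := by rw [hd]; field_simp; ring
        rw [this]; exact h3.trans h4
      exact le_of_mul_le_mul_right h7 hd0
    linarith
  let N : Finset (Fin n) → Finset (Fin k) := fun S => univ.filter fun i => ∃ j ∈ S, v i j ≠ 0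
  -- Minimise the number of rows met, allowing a loss of $\Lambda$ columns per row dropped. The
  -- total loss is at most $\Lambda k=n/4$, so `S` is nonempty. A nonexpanding `E` could be dropped
  -- along with its columns, against minimality.
  obtain ⟨S, hS, hmin⟩ := Finset.exists_min_image
    (S₀.powerset.filter fun S => (#S₀ : ℝ) - Λ * (k - #(N S)) ≤ #S) (fun S => #(N S))
    ⟨S₀, by
      rw [mem_filter]
      refine ⟨mem_powerset_self _, ?_⟩
      have : (#(N S₀) : ℝ) ≤ k := by
        have := card_le_univ (N S₀)
        rw [Fintype.card_fin] at this
        exact_mod_cast this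
      nlinarith⟩
  rw [mem_filter, mem_powerset] at hS
  refine ⟨S, ?_, fun j hj => (mem_filter.mp (hS.1 hj)).2, fun E hE hEN => ?_⟩
  · rw [← card_pos]
    have h1 : Λ * (k - #(N S)) ≤ n / 4 := by
      calc Λ * (k - #(N S)) ≤ Λ * k := by
            have : (0 : ℝ) ≤ #(N S) := Nat.cast_nonneg _
            gcongr; linarith
        _ = n / 4 := by rw [hΛ]; field_simp
    have : (0 : ℝ) < #S := by linarith [hS.2]
    exact_mod_cast this
  · by_contra! hlt
    set S' := S.filter fun j => ¬ ∃ i ∈ E, v i j ≠ 0 with hS'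
    have hcard : (#{j ∈ S | ∃ i ∈ E, v i j ≠ 0} : ℝ) + #S' = #S := by
      exact_mod_cast card_filter_add_card_filter_not (s := S) (fun j => ∃ i ∈ E, v i j ≠ 0)
    have hNdisj : Disjoint (N S') E := by
      rw [Finset.disjoint_left]
      intro i hi hiE
      obtain ⟨j, hj, hne⟩ := (mem_filter.mp hi).2
      exact (mem_filter.mp hj).2 ⟨i, hiE, hne⟩
    have hNsub : N S' ∪ E ⊆ N S := by
      refine union_subset (fun i hi => ?_) fun i hi => ?_
      · obtain ⟨j, hj, hne⟩ := (mem_filter.mp hi).2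
        exact mem_filter.mpr ⟨mem_univ i, j, (mem_filter.mp hj).1, hne⟩
      · exact mem_filter.mpr ⟨mem_univ i, hEN i hi⟩
    have hNcard : #(N S') + #E ≤ #(N S) := by
      rw [← card_union_of_disjoint hNdisj]
      exact card_le_card hNsub
    have hE1 : 0 < #E := card_pos.mpr hE
    have h1 := hmin S' (by
      rw [mem_filter, mem_powerset]
      refine ⟨(filter_subset _ _).trans hS.1, ?_⟩
      have h2 : (#(N S') : ℝ) + #E ≤ #(N S) := by exact_mod_cast hNcard
      have h3 : Λ * ((#(N S') : ℝ) + #E) ≤ Λ * #(N S) := by gcongr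
      have := hS.2
      nlinarith)
    omega

/-! ### Assembly and numerical parameters -/

/-- The lower bound on the size of an essential cover, with the logarithm of `2k`. -/
theorem IsEssentialCover.pow_le {n k : ℕ} {v : Fin k → Fin n → ℝ} {m : Fin k → ℝ}
    (h : IsEssentialCover v m) (hn : 0 < n) :
    (n : ℝ) ^ 5 ≤ 4 * 10 ^ 10 * k ^ 9 * Real.log (2 * k) ^ 4 := by
  have hk : 0 < k := by
    obtain ⟨i, -⟩ := h.all_vars ⟨0, hn⟩
    exact i.pos
  have hn' : (0 : ℝ) < n := by exact_mod_cast hn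
  have hk' : (1 : ℝ) ≤ k := by exact_mod_cast hk
  by_contra! hlt
  obtain ⟨S, ⟨j₀, hj₀⟩, hdeg, hexp⟩ := exists_expanding_columns v hn hk h.card_support_le
  obtain ⟨i₀, hi₀⟩ := h.all_vars j₀
  obtain ⟨x, hx, -, hxj⟩ := h.minimal i₀
  set ℓ := Real.log (2 * k) with hℓ
  have hexpℓ : Real.exp ℓ = 2 * k := Real.exp_log (by positivity)
  have hℓ2 : 2 / 3 ≤ ℓ := by
    have h1 : Real.log 2 ≤ ℓ := Real.log_le_log (by norm_num) (by linarith)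
    linarith [Real.log_two_gt_d9]
  have hℓ0 : 0 < ℓ := by linarith
  have hw2 : (2 * √ℓ) ^ 2 = 4 * ℓ := by rw [mul_pow, Real.sq_sqrt hℓ0.le]; norm_num
  -- With $\ell=\log 2k$: $w^2/2=2\ell$ gives $e^{w^2/2}=(2k)^2$, and $(R-1)/32=6\ell$ gives the
  -- failure factor $(2k)^{-6}$.
  have hex : ∃ Z ⊆ S, ∀ i, (∃ j ∈ S, v i j ≠ 0) →
      ∑ j ∈ Z, v i j ≠ m i - ∑ j ∈ univ \ S, v i j * x j := by
    refine exists_subset_sum_ne v (fun i => m i - ∑ j ∈ univ \ S, v i j * x j) S (R := 1 + 192 * ℓ) (d := 4 * k ^ 2 / n)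
      (w := 2 * √ℓ) (Λ := n / (4 * k)) (s := √(2 * k)) (by positivity) (by positivity)
      (by positivity) (by positivity) (2 * k) (by positivity) ?_ hdeg ?_
      (fun E hE hES => by convert hexp E hE hES) ?_ ?_ ?_
    · push_cast
      rw [Real.sqrt_le_left (by positivity)]
      nlinarith
    · intro i
      rw [Real.sq_sqrt (by positivity)]
      have h1 : #{j ∈ S | v i j ≠ 0} ≤ 2 * k :=
        (card_le_card (filter_subset_filter _ (subset_univ _))).trans (h.card_support_le i)
      exact_mod_cast h1
    · rw [hw2, Fintype.card_fin, show 4 * ℓ / 2 = ℓ + ℓ by ring, Real.exp_add, hexpℓ]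
      nlinarith
    · have e1 : Real.exp (-(1 + 192 * ℓ - 1) / 32) * (2 * k) ^ 6 = 1 := by
        rw [← hexpℓ, ← Real.exp_nat_mul, ← Real.exp_add, Real.exp_eq_one_iff]
        push_cast; ring
      rw [Fintype.card_fin]
      push_cast
      have hk4 : (k : ℝ) ^ 2 ≤ k ^ 6 := pow_le_pow_right₀ hk' (by norm_num)
      calc 4 * (2 * (2 * (k : ℝ)) + 1) * Real.exp (-(1 + 192 * ℓ - 1) / 32) * k
          = Real.exp (-(1 + 192 * ℓ - 1) / 32) * (4 * (2 * (2 * (k : ℝ)) + 1) * k) := by ring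
        _ ≤ Real.exp (-(1 + 192 * ℓ - 1) / 32) * (2 * k) ^ 6 := by
          gcongr
          nlinarith
        _ = 1 := e1
    · rw [hw2, Fintype.card_fin]
      have h1 : 8 * (4 * ℓ) * (4 * (k : ℝ) ^ 2 / n * (k * (1 + 192 * ℓ + 1)))
          ≤ 24960 * k ^ 3 * ℓ ^ 2 / n := by
        rw [le_div_iff₀ hn']
        have : 8 * (4 * ℓ) * (4 * (k : ℝ) ^ 2 / n * (k * (1 + 192 * ℓ + 1))) * n
            = 128 * k ^ 3 * ℓ * (2 + 192 * ℓ) := by field_simp; ring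
        rw [this]
        have h2 : 128 * (k : ℝ) ^ 3 * ℓ * (2 + 192 * ℓ) ≤ 128 * (k : ℝ) ^ 3 * ℓ * (195 * ℓ) := by
          gcongr; linarith
        refine h2.trans (le_of_eq (by ring))
      refine h1.trans_lt ?_
      refine abs_lt_of_sq_lt_sq' ?_ (by positivity) |>.2
      rw [mul_pow, Real.sq_sqrt (by positivity)]
      have e1 : (24960 * (k : ℝ) ^ 3 * ℓ ^ 2 / n) ^ 2
          = (24960 ^ 2 * 64 * k ^ 9 * ℓ ^ 4) / (64 * n ^ 2 * k ^ 3) := by field_simp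
      have e2 : ((n : ℝ) / (4 * k)) ^ 2 * (n / (4 * k)) = n ^ 5 / (64 * n ^ 2 * k ^ 3) := by
        field_simp; ring
      rw [e1, e2]
      gcongr
      refine lt_of_le_of_lt ?_ hlt
      have hc : (24960 : ℝ) ^ 2 * 64 ≤ 4 * 10 ^ 10 := by norm_num
      exact mul_le_mul_of_nonneg_right (mul_le_mul_of_nonneg_right hc (by positivity))
        (by positivity)
  obtain ⟨Z, hZS, hZ⟩ := hex
  -- Rows not meeting `S` take the same value at `y` as at `x`; none of them is `i₀`, so all miss.
  let y : Fin n → ℝ := fun j => if j ∈ S then (if j ∈ Z then 1 else 0) else x j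
  have hy : y ∈ cubeVertices n := by
    intro j
    by_cases hj : j ∈ S
    · by_cases hjZ : j ∈ Z
      · right; simp [y, hj, hjZ]
      · left; simp [y, hj, hjZ]
    · simp only [y, if_neg hj]; exact hx j
  have hdot : ∀ i, v i ⬝ᵥ y = ∑ j ∈ Z, v i j + ∑ j ∈ univ \ S, v i j * x j := by
    intro i
    rw [dotProduct, ← Finset.sum_sdiff (subset_univ S), add_comm]
    congr 1
    · rw [← Finset.sum_subset hZS]
      · exact Finset.sum_congr rfl fun j hj => by simp [y, hZS hj, hj]
      · intro j hj hjZ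
        simp [y, hj, hjZ]
    · refine Finset.sum_congr rfl fun j hj => ?_
      simp only [y, if_neg (mem_sdiff.mp hj).2]
  obtain ⟨i, hi⟩ := h.covers y hy
  have hi' : v i ⬝ᵥ y = m i := hi
  by_cases hiS : ∃ j ∈ S, v i j ≠ 0
  · refine hZ i hiS ?_
    rw [hdot] at hi'
    linarith
  · push Not at hiS
    refine hxj i ?_ ?_
    · rintro rfl
      exact hi₀ (hiS j₀ hj₀)
    · show v i ⬝ᵥ x = m i
      rw [← hi', dotProduct, dotProduct]
      refine Finset.sum_congr rfl fun j _ => ?_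
      by_cases hj : j ∈ S
      · rw [hiS j hj, zero_mul, zero_mul]
      · simp only [y, if_neg hj]

theorem theorem1 :
    ∃ c : ℝ, 0 < c ∧ ∀ (n k : ℕ) (v : Fin k → Fin n → ℝ) (m : Fin k → ℝ),
      2 ≤ n → IsEssentialCover v m →
        c * ((n : ℝ) ^ (5 / 9 : ℝ) / Real.log (n : ℝ) ^ (4 / 9 : ℝ)) ≤ (k : ℝ) := by
  set C : ℝ := 64 * 10 ^ 10 with hC
  have hC0 : 0 < C := by norm_num [hC]
  refine ⟨(C ^ (1 / 9 : ℝ))⁻¹, by positivity, fun n k v m hn h => ?_⟩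
  have hn2 : (2 : ℝ) ≤ n := by exact_mod_cast hn
  have hk0 : (0 : ℝ) ≤ k := Nat.cast_nonneg k
  have hlog2 : Real.log 2 ≤ Real.log n := Real.log_le_log (by norm_num) hn2
  have hlog : 1 / 2 < Real.log n := by linarith [Real.log_two_gt_d9]
  have hmain : (n : ℝ) ^ 5 ≤ C * k ^ 9 * Real.log n ^ 4 := by
    -- For $k>n$ the bound is trivial. Otherwise $\log 2k\le 2\log n$, and the factor $2^4$ turns
    -- $4\cdot10^{10}$ into `C`.
    rcases lt_or_ge n k with hlt | hge
    · have h1 : (n : ℝ) ≤ k := by exact_mod_cast hlt.le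
      calc (n : ℝ) ^ 5 ≤ (n : ℝ) ^ 9 := pow_le_pow_right₀ (by linarith) (by norm_num)
        _ ≤ (k : ℝ) ^ 9 := by gcongr
        _ = C * k ^ 9 * (1 / C) := by field_simp
        _ ≤ C * k ^ 9 * Real.log n ^ 4 := by
          gcongr
          calc 1 / C ≤ (1 / 2) ^ 4 := by norm_num [hC]
            _ ≤ _ := by gcongr
    · have hk : 0 < k := by
        obtain ⟨i, -⟩ := h.all_vars ⟨0, by omega⟩
        exact i.pos
      have hk1 : (1 : ℝ) ≤ k := by exact_mod_cast hk
      have h1 : (k : ℝ) ≤ n := by exact_mod_cast hge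
      have h2 : Real.log (2 * k) ≤ 2 * Real.log n := by
        rw [Real.log_mul (by norm_num) (by positivity)]
        have := Real.log_le_log (by positivity) h1
        linarith
      have h3 : 0 ≤ Real.log (2 * k) := Real.log_nonneg (by linarith)
      calc (n : ℝ) ^ 5 ≤ 4 * 10 ^ 10 * k ^ 9 * Real.log (2 * k) ^ 4 := h.pow_le (by omega)
        _ ≤ 4 * 10 ^ 10 * k ^ 9 * (2 * Real.log n) ^ 4 := by gcongr
        _ = C * k ^ 9 * Real.log n ^ 4 := by rw [hC]; ring
  have hl0 : 0 < Real.log n := by linarith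
  have hroot := Real.rpow_le_rpow (by positivity) hmain (by norm_num : (0 : ℝ) ≤ 1 / 9)
  rw [Real.mul_rpow (by positivity) (by positivity), Real.mul_rpow (by positivity) (by positivity),
    ← Real.rpow_natCast, ← Real.rpow_natCast, ← Real.rpow_natCast, ← Real.rpow_mul (by positivity),
    ← Real.rpow_mul hk0, ← Real.rpow_mul hl0.le] at hroot
  push_cast at hroot
  simp only [show (5 : ℝ) * (1 / 9) = 5 / 9 by norm_num, show (9 : ℝ) * (1 / 9) = 1 by norm_num,
    show (4 : ℝ) * (1 / 9) = 4 / 9 by norm_num, Real.rpow_one] at hroot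
  rw [inv_mul_le_iff₀ (by positivity), div_le_iff₀ (by positivity)]
  exact hroot
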